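/- **Setting.** Identify $\mathbb R^2$ with $\mathbb C$, let $\Theta_\alpha$ be the rotation of $\mathbb R^2$ by the angle $\alpha$ around the origin, let $S^1=\mathbb R/2\pi\mathbb Z$, and let $\int_{S^1}(\cdots)\,d\alpha$ mean $\frac1{2\pi}\int_0^{2\pi}(\cdots)\,d\alpha$. *Bases.* The Fourier basis $\{\varphi_m\}_{m\in\mathbb Z}$ of $S^1$ is $\varphi_0=1$, $\varphi_m(\beta)=\sqrt2\cos(m\beta)$ for $m>0$, and $\varphi_m(\beta)=\sqrt2\sin(|m|\beta)$ for $m<0$. The Fourier–Bessel basis of the unit disk is indexed by the pairs $k=(n,R)$ with $n\in\mathbb Z$ and $R>0$ a zero of the Bessel function $J_{|n|}$: $$\psi_k(r\cos\theta,r\sin\theta)=c_k\,J_{|n|}(Rr)\,\varphi_n(\theta)\quad(r\le1),\qquad \psi_k=0\ \text{ outside the disk},$$ with $c_k>0$ such that $\int\psi_k^2=\pi$; $\mu_k=R^2$ is the corresponding eigenvalue of the Dirichlet Laplacian on the unit disk. Put $\psi_{j,k}(v)=2^{-2j}\psi_k(2^{-j}v)$. *Network.* A RotDCF Net has $M_l\ge1$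 channels in layer $l\ge0$, a nonlinearity $\sigma:\mathbb R\to\mathbb R$, scales $j_l\in\mathbb R$, biases $b^{(l)}(\lambda)\in\mathbb R$, and filters with real coefficients $$W^{(1)}_{\lambda',\lambda}(v)=\sum_k a^{(1)}_{\lambda',\lambda}(k)\,\psi_{j_1,k}(v),\qquad W^{(l)}_{\lambda',\lambda}(v,\beta)=\sum_k\sum_m a^{(l)}_{\lambda',\lambda}(k,m)\,\psi_{j_l,k}(v)\,\varphi_m(\beta)\quad(l>1),$$ where the sums may be finite or infinite and are taken in $L^2$. For an input $x^{(0)}(u,\lambda)$, $u\in\mathbb R^2$, $\lambda\in[M_0]=\{1,\dots,M_0\}$, the outputs $x^{(l)}=x^{(l)}[x^{(0)}]$ are, for $u\in\mathbb R^2$, $\alpha\in S^1$, $\lambda\in[M_l]$, $$x^{(1)}(u,\alpha,\lambda)=\sigma\Big(\sum_{\lambda'=1}^{M_0}\int_{\mathbb R^2}x^{(0)}(u+v',\lambda')\,W^{(1)}_{\lambda',\lambda}(\Theta_\alpha v')\,dv'+b^{(1)}(\lambda)\Big),$$ $$x^{(l)}(u,\alpha,\lambda)=\sigma\Big(\sum_{\lambda'=1}^{M_{l-1}}\int_{S^1}\int_{\mathbb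 R^2}x^{(l-1)}(u+v',\alpha',\lambda')\,W^{(l)}_{\lambda',\lambda}(\Theta_\alpha v',\alpha'-\alpha)\,dv'\,d\alpha'+b^{(l)}(\lambda)\Big),\quad l>1.$$ *Norms.* Let $\|a^{(1)}_{\lambda',\lambda}\|_{\rm FB}^2=\sum_k\mu_k\,a^{(1)}_{\lambda',\lambda}(k)^2$ and $\|a^{(l)}_{\lambda',\lambda}\|_{\rm FB}^2=\sum_{k,m}\mu_k\,a^{(l)}_{\lambda',\lambda}(k,m)^2$ for $l>1$, and $$A_l=\pi\max\Big\{\sup_\lambda\sum_{\lambda'=1}^{M_{l-1}}\|a^{(l)}_{\lambda',\lambda}\|_{\rm FB},\ \sup_{\lambda'}\frac{M_{l-1}}{M_l}\sum_{\lambda=1}^{M_l}\|a^{(l)}_{\lambda',\lambda}\|_{\rm FB}\Big\}.$$ Fix a measurable $\Omega\subset\mathbb R^2$ with $0<|\Omega|<\infty$ (the image domain, used only to normalise) and put $$\|x^{(0)}\|^2=\frac1{M_0}\sum_\lambda\frac1{|\Omega|}\int_{\mathbb R^2}x^{(0)}(u,\lambda)^2\,du,\qquad \|x^{(l)}\|^2=\frac1{M_l}\sum_\lambda\frac1{|\Omega|}\int_{\mathbb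 R^2}\int_{S^1}x^{(l)}(u,\alpha,\lambda)^2\,d\alpha\,du\quad(l\ge1).$$ *Actions.* For the rotation $\rho u=u_0+\Theta_t(u-u_0)$ by the angle $t$ around $u_0\in\mathbb R^2$, and for $\tau:\mathbb R^2\to\mathbb R^2$ of class $C^2$, let $$D_\rho x^{(0)}(u,\lambda)=x^{(0)}(\rho u,\lambda),\quad T_\rho x^{(l)}(u,\alpha,\lambda)=x^{(l)}(\rho u,\alpha-t,\lambda),$$ $$D_\tau x^{(0)}(u,\lambda)=x^{(0)}(u-\tau(u),\lambda),\quad D_\tau x^{(l)}(u,\alpha,\lambda)=x^{(l)}(u-\tau(u),\alpha,\lambda).$$ **Proposition 3.3.** Consider a RotDCF Net with $L$ layers and assume - (A1) $\sigma$ is non-expansive: $|\sigma(s)-\sigma(s')|\le|s-s'|$ for all $s,s'\in\mathbb R$; - (A2) $A_l\le1$ for $l=1,\dots,L$; - (A3) $|\nabla\tau|_\infty:=\sup_u\|\nabla\tau(u)\|<\frac15$, with the operator norm. Then, with $c_1=4$, for every rotation $\rho$, every $x^{(0)}$ whose channels are in $L^2(\mathbb R^2)$, and every $l=1,\dots,L$,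 $$\big\|x^{(l)}[D_\rho\circ D_\tau x^{(0)}]-T_\rho\circ D_\tau\,x^{(l)}[x^{(0)}]\big\|\le 2c_1\,l\,|\nabla\tau|_\infty\,\|x^{(0)}\|.$$ -/

import Mathlib

open MeasureTheory Filter Topology
open scoped ENNReal

namespace RotDCF

noncomputable section

/-! ### The plane, the circle and rotations

The plane `ℝ²` is modelled by `ℂ`, which carries the Euclidean norm and Lebesgue measure. -/

instance instFactTwoPiPos : Fact ((0 : ℝ) < 2 * Real.pi) := ⟨Real.two_pi_pos⟩

/-- The circle `S¹ = ℝ / 2πℤ`, i.e. the group `SO(2)` parametrised by the rotation angle. -/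
abbrev S1 : Type := AddCircle (2 * Real.pi)

/-- The normalised measure `(1 / 2π) dα` on the circle. -/
abbrev circleMeasure : Measure S1 := AddCircle.haarAddCircle

/-- The measure `du dα` on `ℝ² × S¹`, the circle having total mass `1`. -/
abbrev jointMeasure : Measure (ℂ × S1) := (volume : Measure ℂ).prod circleMeasure

/-- `Θ_t`, the rotation of the plane by the angle `t` around the origin: `Θ_t v = e^{it} v`. -/
def rot (t : S1) (v : ℂ) : ℂ := (AddCircle.toCircle t : ℂ) * v

/-- `ρ_{u₀,t}`, the rotation of the plane by the angle `t` around the point `u₀`. -/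
def rotAbout (u₀ : ℂ) (t : S1) (u : ℂ) : ℂ := u₀ + rot t (u - u₀)

/-! ### Fourier and Fourier-Bessel bases (real versions) -/

/-- The Bessel function of the first kind `J_n` of order `n ∈ ℕ`. -/
def besselJ (n : ℕ) (x : ℝ) : ℝ :=
  ∑' i : ℕ, (-1 : ℝ) ^ i / ((i.factorial : ℝ) * ((i + n).factorial : ℝ)) * (x / 2) ^ (2 * i + n)

/-- The real Fourier basis of the circle: `1` for `m = 0`, `√2 cos (m β)` for `m > 0` and
`√2 sin (|m| β)` for `m < 0`. It is orthonormal for the normalised measure. -/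
def circleBasis (m : ℤ) (β : S1) : ℝ :=
  if m = 0 then 1
  else if 0 < m then √2 * (fourier m β).re
  else √2 * (fourier (-m) β).im

/-- Indices `k = (n, R)` of the Fourier-Bessel basis: an integer `n` selecting the angular
function, and a positive zero `R` of the Bessel function `J_{|n|}`. -/
def FBIndex : Type := {p : ℤ × ℝ // 0 < p.2 ∧ besselJ p.1.natAbs p.2 = 0}

/-- The eigenvalue `μ_k = R²` of the Dirichlet Laplacian on the unit disk that belongs to the
Fourier-Bessel function of index `k = (n, R)`. -/
def fbEigenvalue (k : FBIndex) : ℝ := k.1.2 ^ 2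

/-- The Fourier-Bessel function of index `k = (n, R)` before normalisation: in polar coordinates
`J_{|n|}(R r) · (angular function n)(θ)` on the unit disk, and `0` outside. -/
def fbRaw (k : FBIndex) (v : ℂ) : ℝ :=
  if ‖v‖ ≤ 1 then besselJ k.1.1.natAbs (k.1.2 * ‖v‖) * circleBasis k.1.1 ((v.arg : ℝ) : S1)
  else 0

/-- The Fourier-Bessel basis function `ψ_k` of the unit disk, normalised so that its mean square
over the disk is `1`, i.e. `∫ ψ_k² = π`. -/
def fbBasis (k : FBIndex) (v : ℂ) : ℝ :=
  √(Real.pi / ∫ w : ℂ, fbRaw k w ^ 2) * fbRaw k v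

/-- `ψ_{j,k}(v) = 2^{-2j} ψ_k(2^{-j} v)`, the basis function rescaled to the disk of
radius `2^j`. -/
def fbScaled (j : ℝ) (k : FBIndex) (v : ℂ) : ℝ :=
  (2 : ℝ) ^ (-2 * j) * fbBasis k ((((2 : ℝ) ^ (-j) : ℝ) : ℂ) * v)

/-- `W = ∑_k a(k) ψ_{j,k}`, the (finite or infinite) sum being taken in `L²(ℝ²)`. -/
def IsPlaneExpansion (j : ℝ) (a : FBIndex → ℝ) (W : ℂ → ℝ) : Prop :=
  MemLp W 2 volume ∧
    Tendsto (fun s : Finset FBIndex =>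
      eLpNorm (fun v => W v - ∑ k ∈ s, a k * fbScaled j k v) 2 volume) atTop (𝓝 0)

/-- `W(v, β) = ∑_k ∑_m a(k, m) ψ_{j,k}(v) φ_m(β)`, the (finite or infinite) sum being taken
in `L²(ℝ² × S¹)`. -/
def IsJointExpansion (j : ℝ) (a : FBIndex → ℤ → ℝ) (W : ℂ → S1 → ℝ) : Prop :=
  MemLp (fun p : ℂ × S1 => W p.1 p.2) 2 jointMeasure ∧
    Tendsto (fun s : Finset (FBIndex × ℤ) =>
      eLpNorm (fun p : ℂ × S1 => W p.1 p.2 -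
        ∑ q ∈ s, a q.1 q.2 * (fbScaled j q.1 p.1 * circleBasis q.2 p.2)) 2 jointMeasure)
      atTop (𝓝 0)

/-- `‖a‖_FB` for first-layer coefficients (`∞` if the series diverges). -/
def fbNormPlane (a : FBIndex → ℝ) : ℝ≥0∞ :=
  (∑' k, ENNReal.ofReal (fbEigenvalue k * a k ^ 2)) ^ (1 / 2 : ℝ)

/-- `‖a‖_FB` for the coefficients of a joint layer (`∞` if the series diverges). -/
def fbNormJoint (a : FBIndex → ℤ → ℝ) : ℝ≥0∞ :=
  (∑' k, ∑' m, ENNReal.ofReal (fbEigenvalue k * a k m ^ 2)) ^ (1 / 2 : ℝ)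

/-- `π · max { sup_λ ∑_λ' c(λ', λ), sup_λ' (M' / M) ∑_λ c(λ', λ) }` for an array `c` indexed by
`λ' ∈ [M']` and `λ ∈ [M]`. -/
def filterBound {M' M : ℕ} (c : Fin M' → Fin M → ℝ≥0∞) : ℝ≥0∞ :=
  ENNReal.ofReal Real.pi *
    max (⨆ i, ∑ i', c i' i) (⨆ i', (M' : ℝ≥0∞) / (M : ℝ≥0∞) * ∑ i, c i' i)

/-! ### The network -/

/-- A RotDCF Net. Layer `0` is the input, layer `1` the first convolutional layer; the fields
`j`, `a`, `W`, `b` at `l` belong to layer `l + 2`. Only finitely many layers matter for any given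
output; a network of finite depth is prolonged arbitrarily. -/
structure RotDCFNet where
  /-- the nonlinearity -/
  σ : ℝ → ℝ
  /-- `M l` is the number of unstructured channels of layer `l` -/
  M : ℕ → ℕ
  M_pos : ∀ l, 0 < M l
  /-- scale, coefficients, filters and biases of the first layer -/
  j₁ : ℝ
  a₁ : Fin (M 0) → Fin (M 1) → FBIndex → ℝ
  W₁ : Fin (M 0) → Fin (M 1) → ℂ → ℝ
  b₁ : Fin (M 1) → ℝ
  expansion₁ : ∀ i' i, IsPlaneExpansion j₁ (a₁ i' i) (W₁ i' i)
  /-- scale, coefficients, filters and biases of layer `l + 2` -/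
  j : ℕ → ℝ
  a : ∀ l, Fin (M (l + 1)) → Fin (M (l + 2)) → FBIndex → ℤ → ℝ
  W : ∀ l, Fin (M (l + 1)) → Fin (M (l + 2)) → ℂ → S1 → ℝ
  b : ∀ l, Fin (M (l + 2)) → ℝ
  expansion : ∀ l i' i, IsJointExpansion (j l) (a l i' i) (W l i' i)

/-- An input image `x⁽⁰⁾(u, λ)` with `M` channels. -/
abbrev Image (M : ℕ) : Type := ℂ → Fin M → ℝ

/-- A layer output `x⁽ˡ⁾(u, α, λ)`, `l ≥ 1`, with `M` unstructured channels. -/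
abbrev Feature (M : ℕ) : Type := ℂ → S1 → Fin M → ℝ

namespace RotDCFNet

/-- The first layer. -/
def firstLayer (N : RotDCFNet) (x : Image (N.M 0)) : Feature (N.M 1) := fun u α i =>
  N.σ (∑ i', (∫ v : ℂ, x (u + v) i' * N.W₁ i' i (rot α v)) + N.b₁ i)

/-- Layer `l + 2`: the joint convolution over `ℝ² × S¹`, applied to an output of layer `l + 1`. -/
def jointLayer (N : RotDCFNet) (l : ℕ) (x : Feature (N.M (l + 1))) : Feature (N.M (l + 2)) :=
  fun u α i =>
    N.σ (∑ i', (∫ p : ℂ × S1, x (u + p.1) p.2 i' * N.W l i' i (rot α p.1) (p.2 - α) ∂jointMeasure)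
      + N.b l i)

/-- `N.output x₀ l` is the output `x⁽ˡ⁺¹⁾[x₀]` of layer `l + 1` from the input `x₀`. -/
def output (N : RotDCFNet) (x₀ : Image (N.M 0)) : (l : ℕ) → Feature (N.M (l + 1))
  | 0 => N.firstLayer x₀
  | l + 1 => N.jointLayer l (N.output x₀ l)

/-- `N.A l` is the constant `A_{l+1}` of layer `l + 1`. -/
def A (N : RotDCFNet) : ℕ → ℝ≥0∞
  | 0 => filterBound fun i' i => fbNormPlane (N.a₁ i' i)
  | l + 1 => filterBound fun i' i => fbNormJoint (N.a l i' i)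

end RotDCFNet

/-! ### Norms -/

/-- `‖x⁽⁰⁾‖`, where `‖x‖² = (1/M) ∑_λ (1/|Ω|) ∫ x(u, λ)² du`. -/
def imageNorm (Ω : Set ℂ) {M : ℕ} (x : Image M) : ℝ≥0∞ :=
  ((M : ℝ≥0∞)⁻¹ * ∑ i, (volume Ω)⁻¹ * ∫⁻ u : ℂ, ‖x u i‖ₑ ^ 2) ^ (1 / 2 : ℝ)

/-- `‖x⁽ˡ⁾‖`, where `‖x‖² = (1/M) ∑_λ (1/|Ω|) ∫∫ x(u, α, λ)² du dα`. -/
def featureNorm (Ω : Set ℂ) {M : ℕ} (x : Feature M) : ℝ≥0∞ :=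
  ((M : ℝ≥0∞)⁻¹ * ∑ i, (volume Ω)⁻¹ * ∫⁻ p : ℂ × S1, ‖x p.1 p.2 i‖ₑ ^ 2 ∂jointMeasure)
    ^ (1 / 2 : ℝ)

/-! ### Actions on images and features -/

/-- `D_ρ` on images, for `ρ = ρ_{u₀,t}`. -/
def rotateImage (u₀ : ℂ) (t : S1) {M : ℕ} (x : Image M) : Image M :=
  fun u i => x (rotAbout u₀ t u) i

/-- `T_ρ` on layer outputs, for `ρ = ρ_{u₀,t}`. -/
def rotateFeature (u₀ : ℂ) (t : S1) {M : ℕ} (x : Feature M) : Feature M :=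
  fun u α i => x (rotAbout u₀ t u) (α - t) i

/-- `D_τ` on images. -/
def deformImage (τ : ℂ → ℂ) {M : ℕ} (x : Image M) : Image M :=
  fun u i => x (u - τ u) i

/-- `D_τ` on layer outputs, acting on the space variable only. -/
def deformFeature (τ : ℂ → ℂ) {M : ℕ} (x : Feature M) : Feature M :=
  fun u α i => x (u - τ u) α i

/-- `|∇τ|_∞ = sup_u ‖∇τ(u)‖`, with the operator norm of the real differential. -/
def gradSup (τ : ℂ → ℂ) : ℝ≥0∞ := ⨆ u, ‖fderiv ℝ τ u‖ₑ

end

end RotDCF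

/-!
The layers commute exactly with rotations, so only the commutator of each layer with `D_τ` has to be
estimated. A joint convolution is an integral operator, and after the change of variables
`u ↦ u - τ u` its commutator with `D_τ` is one as well, with a kernel made of the deviation of the
Jacobian from `1` and of an increment of the filter `W` between the original and the deformed
position. Schur's test bounds the convolution by `‖W‖₁` and the commutator by a multiple of
`|∇τ|_∞ (‖W‖₁ + ‖|v| ∇_v W‖₁)`.

If `W` is a finite Fourier-Bessel sum of scale `0`, it vanishes on the unit circle, its gradient has
`L²` norm at most `√π ‖a‖_FB` because the `ψ_k` are orthogonal Dirichlet eigenfunctions, and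
`‖W‖₂ ≤ ‖∇_v W‖₂` by Poincaré's inequality; Cauchy-Schwarz on the disk then gives
`‖W‖₁, ‖∇_v W‖₁ ≤ π ‖a‖_FB`. Other scales follow by dilation and infinite sums by passing to the
limit, so (A2) makes every layer non-expansive and bounds its commutator. The errors add up over the
layers.
-/

namespace RotDCF

noncomputable section

open InnerProductSpace
open scoped Laplacian Gradient

/-! ### Bessel functions as power series -/

/-- The coefficients of the entire function `h_n` with `J_n(x) = (x/2)^n h_n(x²/4)`. -/
def besselCoeff (n i : ℕ) : ℝ :=
  (-1 : ℝ) ^ i / ((i.factorial : ℝ) * ((i + n).factorial : ℝ))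

/-- The entire function `h_n` with `J_n(x) = (x/2)^n h_n(x²/4)`; unlike `J_n(|v|)` it makes the
Fourier-Bessel functions visibly smooth at the origin. -/
def besselEntire (n : ℕ) (t : ℝ) : ℝ := ∑' i : ℕ, besselCoeff n i * t ^ i

lemma besselJ_eq (n : ℕ) (x : ℝ) : besselJ n x = (x / 2) ^ n * besselEntire n (x ^ 2 / 4) := by
  unfold besselJ besselEntire besselCoeff
  rw [← tsum_mul_left]
  refine tsum_congr fun i => ?_
  rw [pow_add, pow_mul, div_pow, show (2 : ℝ) ^ 2 = 4 by norm_num]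
  ring

lemma abs_besselCoeff_le (n i : ℕ) : |besselCoeff n i| ≤ (i.factorial : ℝ)⁻¹ := by
  have h : (1 : ℝ) ≤ (i + n).factorial := mod_cast Nat.factorial_pos _
  rw [besselCoeff, abs_div, abs_pow, abs_neg, abs_one, one_pow, abs_of_pos (by positivity), one_div]
  exact inv_anti₀ (by positivity) (le_mul_of_one_le_right (by positivity) h)

lemma besselCoeff_succ_mul (n i : ℕ) :
    besselCoeff n (i + 1) * ((i : ℝ) + 1) = -besselCoeff (n + 1) i := by
  unfold besselCoeff
  rw [show i + 1 + n = i + (n + 1) by ring, Nat.factorial_succ i]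
  push_cast
  field_simp
  ring

lemma besselCoeff_eq_mul_succ (n i : ℕ) :
    besselCoeff n i = ((i : ℝ) + n + 1) * besselCoeff (n + 1) i := by
  unfold besselCoeff
  rw [← add_assoc, Nat.factorial_succ (i + n)]
  push_cast
  field_simp

lemma hasSum_besselEntire (n : ℕ) (t : ℝ) :
    HasSum (fun i => besselCoeff n i * t ^ i) (besselEntire n t) := by
  refine (Summable.of_norm_bounded (Real.summable_pow_div_factorial |t|) fun i => ?_).hasSum
  rw [norm_mul, norm_pow, Real.norm_eq_abs, Real.norm_eq_abs, div_eq_inv_mul]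
  gcongr
  exact abs_besselCoeff_le n i

lemma hasSum_deriv_besselEntire (n : ℕ) (t : ℝ) :
    HasSum (fun i : ℕ => besselCoeff n i * (i * t ^ (i - 1))) (-besselEntire (n + 1) t) := by
  rw [← hasSum_nat_add_iff' 1]
  simp only [Finset.range_one, Finset.sum_singleton, Nat.cast_zero, zero_mul, mul_zero, sub_zero,
    Nat.add_sub_cancel, Nat.cast_add, Nat.cast_one, ← mul_assoc, besselCoeff_succ_mul, neg_mul]
  exact (hasSum_besselEntire (n + 1) t).neg

lemma hasDerivAt_besselEntire (n : ℕ) (t : ℝ) :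
    HasDerivAt (besselEntire n) (-besselEntire (n + 1) t) t := by
  have hbound : Summable fun i : ℕ => (i : ℝ) * (|t| + 1) ^ (i - 1) / (i.factorial : ℝ) := by
    rw [← summable_nat_add_iff 1]
    refine (Real.summable_pow_div_factorial (|t| + 1)).congr fun i => ?_
    rw [Nat.factorial_succ, Nat.add_sub_cancel]
    push_cast
    field_simp
  rw [← (hasSum_deriv_besselEntire n t).tsum_eq]
  refine hasDerivAt_tsum_of_isPreconnected (t := Metric.ball 0 (|t| + 1)) (y₀ := t) hbound
    Metric.isOpen_ball (convex_ball _ _).isPreconnected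
    (fun i y _ => (hasDerivAt_pow i y).const_mul _) (fun i y hy => ?_) (by simp)
    (hasSum_besselEntire n t).summable (by simp)
  have hy' : ‖y‖ ≤ |t| + 1 := by simpa using (Metric.mem_ball.mp hy).le
  rw [norm_mul, norm_mul, norm_pow, div_eq_inv_mul, Real.norm_natCast]
  gcongr
  exact abs_besselCoeff_le n i

open scoped ContDiff in
lemma contDiff_besselEntire (n : ℕ) : ContDiff ℝ ∞ (besselEntire n) := by
  refine contDiff_infty.2 fun m => ?_
  induction m generalizing n with
  | zero =>
    exact contDiff_zero.mpr (continuous_iff_continuousAt.mpr fun t =>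
      (hasDerivAt_besselEntire n t).continuousAt)
  | succ m ih =>
    rw [Nat.cast_add, Nat.cast_one, contDiff_succ_iff_deriv]
    refine ⟨fun t => (hasDerivAt_besselEntire n t).differentiableAt, by simp, ?_⟩
    rw [show deriv (besselEntire n) = fun t => -besselEntire (n + 1) t from
      funext fun t => (hasDerivAt_besselEntire n t).deriv]
    exact (ih (n + 1)).neg

/-- Bessel's equation: by `hasDerivAt_besselEntire` it reads `t h'' + (n + 1) h' + h = 0`. -/
lemma besselEntire_recurrence (n : ℕ) (t : ℝ) :
    t * besselEntire (n + 2) t - (n + 1) * besselEntire (n + 1) t + besselEntire n t = 0 := by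
  have h := ((hasSum_deriv_besselEntire (n + 1) t).mul_left t).add
    ((hasSum_besselEntire (n + 1) t).mul_left ((n : ℝ) + 1))
  have hterm (i : ℕ) : t * (besselCoeff (n + 1) i * (i * t ^ (i - 1)))
      + (n + 1) * (besselCoeff (n + 1) i * t ^ i) = besselCoeff n i * t ^ i := by
    rw [besselCoeff_eq_mul_succ n i]
    rcases i with _ | i
    · simp
    · rw [Nat.add_sub_cancel]; ring
  simp only [hterm] at h
  linarith [h.unique (hasSum_besselEntire n t)]

/-! ### The real Fourier basis of the circle -/

/-- The complex amplitude `w` with `circleBasis n β = Re (w e^{i|n|β})`. -/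
def angularCoeff (n : ℤ) : ℂ :=
  if n = 0 then 1 else if 0 < n then (√2 : ℝ) else -((√2 : ℝ) * Complex.I)

lemma circleBasis_eq_re (n : ℤ) (β : S1) :
    circleBasis n β = (angularCoeff n * fourier (n.natAbs : ℤ) β).re := by
  unfold circleBasis angularCoeff
  split_ifs with h0 h1
  · simp [h0]
  · rw [Int.natAbs_of_nonneg h1.le]; simp
  · rw [show (n.natAbs : ℤ) = -n by omega]; simp

lemma continuous_circleBasis (n : ℤ) : Continuous (circleBasis n) := by
  rw [show circleBasis n = _ from funext (circleBasis_eq_re n)]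
  fun_prop

lemma integrable_circle {E : Type*} [NormedAddCommGroup E] {f : S1 → E} (hf : Continuous f) :
    Integrable f circleMeasure :=
  hf.integrable_of_hasCompactSupport (HasCompactSupport.of_compactSpace f)

lemma integral_fourier (m : ℤ) :
    ∫ β : S1, fourier m β ∂circleMeasure = if m = 0 then 1 else 0 := by
  have h := congrFun (fourierCoeff_fourier (T := 2 * Real.pi) m) 0
  simpa [fourierCoeff, Pi.single_apply, eq_comm] using h

lemma integral_re_mul_fourier (w : ℂ) (m : ℤ) :
    ∫ β : S1, (w * fourier m β).re ∂circleMeasure = if m = 0 then w.re else 0 := by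
  have h : ∫ β : S1, (w * fourier m β).re ∂circleMeasure =
      (∫ β : S1, w * fourier m β ∂circleMeasure).re :=
    integral_re (𝕜 := ℂ) (f := fun β : S1 => w * fourier m β) (integrable_circle (by fun_prop))
  rw [h, integral_const_mul, integral_fourier]
  split_ifs <;> simp

lemma circleBasis_mul_circleBasis (m m' : ℤ) (β : S1) :
    circleBasis m β * circleBasis m' β =
      ((angularCoeff m * angularCoeff m' * fourier ((m.natAbs : ℤ) + m'.natAbs) β).re
        + (angularCoeff m * starRingEnd ℂ (angularCoeff m')
          * fourier ((m.natAbs : ℤ) - m'.natAbs) β).re) / 2 := by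
  rw [circleBasis_eq_re, circleBasis_eq_re, sub_eq_add_neg, fourier_add, fourier_add, fourier_neg]
  simp only [Complex.mul_re, Complex.mul_im, Complex.conj_re, Complex.conj_im]
  ring

lemma re_angularCoeff_mul_conj {m m' : ℤ} (h : m.natAbs = m'.natAbs) :
    (angularCoeff m * starRingEnd ℂ (angularCoeff m')).re =
      if m = m' then (if m = 0 then 1 else 2) else 0 := by
  rcases Int.natAbs_eq_natAbs_iff.mp h with rfl | rfl <;> unfold angularCoeff <;>
    split_ifs <;> first | omega | simp

lemma integral_circleBasis_mul (m m' : ℤ) :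
    ∫ β : S1, circleBasis m β * circleBasis m' β ∂circleMeasure = if m = m' then 1 else 0 := by
  simp only [circleBasis_mul_circleBasis]
  rw [integral_div, integral_add (integrable_circle (by fun_prop))
    (integrable_circle (by fun_prop)), integral_re_mul_fourier, integral_re_mul_fourier]
  have hsum : (m.natAbs : ℤ) + m'.natAbs = 0 ↔ m = 0 ∧ m' = 0 := by omega
  have hsub : (m.natAbs : ℤ) - m'.natAbs = 0 ↔ m.natAbs = m'.natAbs := by omega
  simp only [hsum, hsub]
  by_cases habs : m.natAbs = m'.natAbs
  · rw [if_pos habs, re_angularCoeff_mul_conj habs]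
    rcases eq_or_ne m 0 with rfl | hm
    · simp [angularCoeff, show m' = 0 by omega]
    · simp only [hm, false_and, if_false]; split_ifs <;> norm_num
  · rw [if_neg habs, if_neg (by omega), if_neg (by rintro rfl; exact habs rfl)]
    simp

/-! ### Smooth Fourier-Bessel functions -/

/-- The smooth function `h_m(c |v|²) Re (w v^n)`, with `h_m` as in `besselEntire`. The span of
these functions is closed under differentiation, and each Fourier-Bessel function is a multiple of
one of them on the unit disk. -/
def besselBlock (c : ℝ) (m n : ℕ) (w v : ℂ) : ℝ :=
  besselEntire m (c * ‖v‖ ^ 2) * (w * v ^ n).re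

/-- The extension of `fbBasis k` to an eigenfunction of the Laplacian on the whole plane. -/
def fbSmooth (k : FBIndex) (v : ℂ) : ℝ :=
  √(Real.pi / ∫ w : ℂ, fbRaw k w ^ 2) * (k.1.2 / 2) ^ k.1.1.natAbs *
    besselBlock (k.1.2 ^ 2 / 4) k.1.1.natAbs k.1.1.natAbs (angularCoeff k.1.1) v

open scoped ContDiff in
lemma contDiff_besselBlock (c : ℝ) (m n : ℕ) (w : ℂ) : ContDiff ℝ ∞ (besselBlock c m n w) :=
  ((contDiff_besselEntire m).comp (contDiff_const.mul (contDiff_norm_sq ℝ))).mul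
    (Complex.reCLM.contDiff.comp (contDiff_const.mul (contDiff_id.pow n)))

lemma differentiable_besselBlock (c : ℝ) (m n : ℕ) (w : ℂ) :
    Differentiable ℝ (besselBlock c m n w) :=
  (contDiff_besselBlock c m n w).differentiable (by simp)

lemma fderiv_besselBlock (c : ℝ) (m n : ℕ) (w v e : ℂ) :
    fderiv ℝ (besselBlock c m n w) v e =
      -2 * c * ⟪v, e⟫_ℝ * besselBlock c (m + 1) n w v + besselBlock c m (n - 1) (n * w * e) v := by
  have hradial := (hasDerivAt_besselEntire m (c * ‖v‖ ^ 2)).comp_hasFDerivAt v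
    ((hasStrictFDerivAt_norm_sq v).hasFDerivAt.const_mul c)
  have hpow : HasDerivAt (fun v : ℂ => w * v ^ n) (w * (n * v ^ (n - 1))) v :=
    (hasDerivAt_pow n v).const_mul w
  have hangular := Complex.reCLM.hasFDerivAt.comp v (hpow.hasFDerivAt.restrictScalars ℝ)
  have h : HasFDerivAt (besselBlock c m n w) _ v := hradial.mul hangular
  rw [h.fderiv]
  simp only [besselBlock, Function.comp, add_apply, smul_apply, ContinuousLinearMap.comp_apply,
    Complex.reCLM_apply, smul_eq_mul, ContinuousLinearMap.coe_restrictScalars',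
    ContinuousLinearMap.toSpanSingleton_apply, innerSL_apply_apply, nsmul_eq_mul]
  rw [show (n : ℂ) * w * e * v ^ (n - 1) = e * (w * (n * v ^ (n - 1))) by ring]
  push_cast
  ring

lemma fderiv_fderiv_besselBlock (c : ℝ) (m n : ℕ) (w v e : ℂ) :
    fderiv ℝ (fun u => fderiv ℝ (besselBlock c m n w) u e) v e =
      -2 * c * ‖e‖ ^ 2 * besselBlock c (m + 1) n w v
        + 4 * c ^ 2 * ⟪v, e⟫_ℝ ^ 2 * besselBlock c (m + 2) n w v
        - 4 * c * ⟪v, e⟫_ℝ * besselBlock c (m + 1) (n - 1) (n * w * e) v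
        + besselBlock c m (n - 2) (↑(n - 1) * (n * w * e) * e) v := by
  have hinner : HasFDerivAt (fun u : ℂ => -2 * c * ⟪u, e⟫_ℝ) ((-2 * c) • innerSL ℝ e) v := by
    simp only [real_inner_comm e]
    exact ((innerSL ℝ e).hasFDerivAt (x := v)).const_mul (-2 * c)
  have h : HasFDerivAt (fun u => -2 * c * ⟪u, e⟫_ℝ * besselBlock c (m + 1) n w u
      + besselBlock c m (n - 1) (n * w * e) u) _ v :=
    (hinner.mul (differentiable_besselBlock c (m + 1) n w v).hasFDerivAt).add
      (differentiable_besselBlock c m (n - 1) (n * w * e) v).hasFDerivAt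
  simp only [fderiv_besselBlock c m n w, h.fderiv]
  simp only [add_apply, smul_apply, smul_eq_mul, fderiv_besselBlock, innerSL_apply_apply,
    real_inner_self_eq_norm_sq, Nat.sub_sub]
  ring

/-- Euler's identity for the homogeneous polynomial `Re (w v^n)`. -/
lemma inner_one_mul_besselBlock_add (c : ℝ) (m n : ℕ) (w v : ℂ) :
    ⟪v, 1⟫_ℝ * besselBlock c m (n - 1) (n * w * 1) v
      + ⟪v, Complex.I⟫_ℝ * besselBlock c m (n - 1) (n * w * Complex.I) v
      = n * besselBlock c m n w v := by
  rcases n with _ | n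
  · simp [besselBlock]
  · simp only [besselBlock, Complex.inner, Nat.add_sub_cancel]
    rw [show w * v ^ (n + 1) = w * v ^ n * v by ring,
      show ((n + 1 : ℕ) : ℂ) * w * 1 * v ^ n = ((n + 1 : ℝ) : ℂ) * (w * v ^ n) by push_cast; ring,
      show ((n + 1 : ℕ) : ℂ) * w * Complex.I * v ^ n
        = ((n + 1 : ℝ) : ℂ) * (w * v ^ n * Complex.I) by push_cast; ring,
      Complex.re_ofReal_mul, Complex.re_ofReal_mul, Complex.mul_re _ Complex.I, Complex.mul_re _ v]
    simp only [Complex.mul_re, Complex.conj_re, Complex.conj_im, Complex.one_re, Complex.one_im,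
      Complex.I_re, Complex.I_im]
    push_cast
    ring

lemma laplacian_eq_fderiv_fderiv {f : ℂ → ℝ} (hf : ContDiff ℝ 2 f) (v : ℂ) :
    Δ f v = fderiv ℝ (fun u => fderiv ℝ f u 1) v 1
      + fderiv ℝ (fun u => fderiv ℝ f u Complex.I) v Complex.I := by
  have h : DifferentiableAt ℝ (fderiv ℝ f) v :=
    (hf.fderiv_right (m := 1) (by norm_num)).differentiable (by simp) v
  simp only [laplacian_eq_iteratedFDeriv_complexPlane, iteratedFDeriv_two_apply,
    fderiv_clm_apply h (differentiableAt_const _)]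
  simp

lemma laplacian_besselBlock (c : ℝ) (n : ℕ) (w v : ℂ) :
    Δ (besselBlock c n n w) v = -4 * c * besselBlock c n n w v := by
  rw [laplacian_eq_fderiv_fderiv (mod_cast contDiff_infty.1 (contDiff_besselBlock c n n w) 2),
    fderiv_fderiv_besselBlock, fderiv_fderiv_besselBlock]
  have heuler := inner_one_mul_besselBlock_add c (n + 1) n w v
  have hrec := besselEntire_recurrence n (c * ‖v‖ ^ 2)
  have hnorm : ⟪v, 1⟫_ℝ ^ 2 + ⟪v, Complex.I⟫_ℝ ^ 2 = ‖v‖ ^ 2 := by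
    rw [← Complex.normSq_eq_norm_sq, Complex.normSq_apply]
    simp [Complex.inner, sq]
  -- `z ↦ Re (w z^n)` is harmonic
  have hharm : besselBlock c n (n - 2) (↑(n - 1) * (n * w * Complex.I) * Complex.I) v
      = -besselBlock c n (n - 2) (↑(n - 1) * (n * w * 1) * 1) v := by
    unfold besselBlock
    rw [show (↑(n - 1) * (n * w * Complex.I) * Complex.I : ℂ) = -(↑(n - 1) * (n * w * 1) * 1) by
      linear_combination (↑(n - 1) * (n * w) : ℂ) * Complex.I_mul_I, neg_mul, Complex.neg_re,
      mul_neg]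
  rw [hharm, norm_one, Complex.norm_I]
  simp only [besselBlock] at heuler ⊢
  linear_combination 4 * c * (w * v ^ n).re * hrec - 4 * c * heuler
    + 4 * c ^ 2 * (besselEntire (n + 2) (c * ‖v‖ ^ 2) * (w * v ^ n).re) * hnorm

open scoped ContDiff in
lemma contDiff_fbSmooth (k : FBIndex) : ContDiff ℝ ∞ (fbSmooth k) :=
  contDiff_const.mul (contDiff_besselBlock _ _ _ _)

lemma laplacian_fbSmooth (k : FBIndex) (v : ℂ) :
    Δ (fbSmooth k) v = -fbEigenvalue k * fbSmooth k v := by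
  have hblock : ContDiff ℝ 2 (besselBlock (k.1.2 ^ 2 / 4) k.1.1.natAbs k.1.1.natAbs
      (angularCoeff k.1.1)) := mod_cast contDiff_infty.1 (contDiff_besselBlock _ _ _ _) 2
  refine (laplacian_smul (√(Real.pi / ∫ w : ℂ, fbRaw k w ^ 2) * (k.1.2 / 2) ^ k.1.1.natAbs)
    hblock.contDiffAt).trans ?_
  rw [laplacian_besselBlock, smul_eq_mul, fbSmooth, fbEigenvalue]
  ring

lemma norm_pow_mul_fourier_arg (n : ℕ) (v : ℂ) :
    (‖v‖ : ℂ) ^ n * fourier (n : ℤ) ((v.arg : ℝ) : S1) = v ^ n := by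
  rw [fourier_coe_apply, show 2 * (Real.pi : ℂ) * Complex.I * ((n : ℤ) : ℂ) * (v.arg : ℂ) /
    ((2 * Real.pi : ℝ) : ℂ) = n * (v.arg * Complex.I) by
      have : (Real.pi : ℂ) ≠ 0 := mod_cast Real.pi_ne_zero
      push_cast; field_simp, Complex.exp_nat_mul, ← mul_pow, Complex.norm_mul_exp_arg_mul_I]

lemma fbBasis_eq_indicator (k : FBIndex) :
    fbBasis k = (Metric.closedBall (0 : ℂ) 1).indicator (fbSmooth k) := by
  ext v
  by_cases hv : ‖v‖ ≤ 1
  · rw [Set.indicator_of_mem (by simpa using hv), fbBasis, fbRaw, if_pos hv, fbSmooth, besselJ_eq,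
      circleBasis_eq_re, besselBlock, ← norm_pow_mul_fourier_arg,
      show (k.1.2 * ‖v‖) ^ 2 / 4 = k.1.2 ^ 2 / 4 * ‖v‖ ^ 2 by ring,
      mul_left_comm (angularCoeff _), ← Complex.ofReal_pow, Complex.re_ofReal_mul]
    ring
  · rw [Set.indicator_of_notMem (by simpa using hv), fbBasis, fbRaw, if_neg hv, mul_zero]

lemma fbSmooth_eq_zero (k : FBIndex) {v : ℂ} (hv : ‖v‖ = 1) : fbSmooth k v = 0 := by
  have h := congrFun (fbBasis_eq_indicator k) v
  rw [Set.indicator_of_mem (by simp [hv]), fbBasis, fbRaw, if_pos hv.le, hv, mul_one, k.2.2] at h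
  simpa using h.symm

/-! ### Green's identity and Poincaré's inequality -/

section ZeroBoundary

variable {E : Type*} [NormedAddCommGroup E] [NormedSpace ℝ E] {s : Set E} {f : E → ℝ}

lemma exists_mem_segment_inter_frontier {x y : E} (hx : x ∈ s) (hy : y ∉ s) :
    ∃ z ∈ segment ℝ x y, z ∈ frontier s := by
  by_contra! h
  have hcover : segment ℝ x y ⊆ interior s ∪ interior sᶜ := fun z hz => by
    rw [← compl_frontier_eq_union_interior]
    exact h z hz
  have hdisj : Disjoint (interior s) (interior sᶜ) :=
    disjoint_compl_right.mono interior_subset interior_subset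
  rcases (convex_segment x y).isPreconnected.subset_or_subset isOpen_interior isOpen_interior
    hdisj hcover with hsub | hsub
  · exact hy (interior_subset (hsub (right_mem_segment ℝ x y)))
  · exact interior_subset (hsub (left_mem_segment ℝ x y)) hx

lemma lipschitzWith_indicator {C : NNReal} (hf : LipschitzOnWith C f s) (hs : IsClosed s)
    (hbdry : ∀ x ∈ frontier s, f x = 0) : LipschitzWith C (s.indicator f) := by
  have hcross {x y : E} (hx : x ∈ s) (hy : y ∉ s) : ‖f x‖ ≤ C * dist x y := by
    obtain ⟨z, hz, hzs⟩ := exists_mem_segment_inter_frontier hx hy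
    have hle := hf.dist_le_mul x hx z (hs.frontier_subset hzs)
    rw [hbdry z hzs, dist_zero_right] at hle
    have hxz : dist x z ≤ dist x y :=
      (le_add_of_nonneg_right dist_nonneg).trans_eq (dist_add_dist_of_mem_segment hz)
    exact hle.trans (by gcongr)
  refine LipschitzWith.of_dist_le_mul fun x y => ?_
  by_cases hx : x ∈ s <;> by_cases hy : y ∈ s
  · simpa [hx, hy] using hf.dist_le_mul x hx y hy
  · simpa [hx, hy] using hcross hx hy
  · simpa [hx, hy, dist_comm] using hcross hy hx
  · simp [hx, hy, mul_nonneg]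

lemma hasFDerivAt_indicator {x : E} (hf : DifferentiableAt ℝ f x) (hx : x ∉ frontier s) :
    HasFDerivAt (s.indicator f) (s.indicator (fderiv ℝ f) x) x := by
  rw [← Set.mem_compl_iff, compl_frontier_eq_union_interior] at hx
  rcases hx with hx | hx
  · rw [Set.indicator_of_mem (interior_subset hx)]
    exact hf.hasFDerivAt.congr_of_eventuallyEq
      (Set.eqOn_indicator.eventuallyEq_of_mem (mem_interior_iff_mem_nhds.1 hx))
  · rw [Set.indicator_of_notMem (interior_subset hx)]
    exact (hasFDerivAt_const 0 x).congr_of_eventuallyEq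
      (Set.eqOn_indicator'.eventuallyEq_of_mem (mem_interior_iff_mem_nhds.1 hx))

variable [MeasurableSpace E] [BorelSpace E] {μ : Measure E}

lemma setIntegral_fderiv_apply_eq_zero [FiniteDimensional ℝ E] [μ.IsAddHaarMeasure]
    (hs : Convex ℝ s) (hsc : IsCompact s) (hf : ContDiff ℝ 1 f) (hbdry : ∀ x ∈ frontier s, f x = 0)
    (e : E) : ∫ x in s, fderiv ℝ f x e ∂μ = 0 := by
  obtain ⟨C, hC⟩ := hsc.exists_bound_of_continuousOn (hf.continuous_fderiv (by simp)).continuousOn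
  have hlip : LipschitzOnWith C.toNNReal f s := hs.lipschitzOnWith_of_nnnorm_fderiv_le
    (fun x _ => hf.differentiable (by simp) x) fun x hx => NNReal.le_toNNReal_of_coe_le (hC x hx)
  have hsupp : HasCompactSupport (s.indicator f) :=
    HasCompactSupport.intro hsc fun x hx => Set.indicator_of_notMem hx f
  have hzero := LipschitzWith.integral_lineDeriv_mul_eq (μ := μ) (C := 0)
    (LipschitzWith.const (1 : ℝ)) (lipschitzWith_indicator hlip hsc.isClosed hbdry) hsupp (-e)
  have hae : (fun x => lineDeriv ℝ (s.indicator f) x e)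
      =ᵐ[μ] s.indicator fun x => fderiv ℝ f x e := by
    filter_upwards [compl_mem_ae_iff.2 (hs.addHaar_frontier μ)] with x hx
    rw [((hasFDerivAt_indicator (hf.differentiable (by simp) x) hx).hasLineDerivAt e).lineDeriv]
    by_cases hxs : x ∈ s <;> simp [hxs]
  rw [← integral_indicator hsc.measurableSet, ← integral_congr_ae hae]
  simpa [lineDeriv] using hzero.symm

end ZeroBoundary

lemma continuous_fderiv_apply {f : ℂ → ℝ} (hf : ContDiff ℝ 1 f) (e : ℂ) :
    Continuous fun v => fderiv ℝ f v e :=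
  (hf.continuous_fderiv (by simp)).clm_apply continuous_const

lemma continuous_gradient {f : ℂ → ℝ} (hf : ContDiff ℝ 1 f) : Continuous (∇ f) :=
  (toDual ℝ ℂ).symm.continuous.comp (hf.continuous_fderiv (by simp))

lemma norm_gradient (f : ℂ → ℝ) (v : ℂ) : ‖∇ f v‖ = ‖fderiv ℝ f v‖ :=
  (toDual ℝ ℂ).symm.norm_map _

lemma inner_gradient_gradient (f g : ℂ → ℝ) (v : ℂ) :
    ⟪∇ f v, ∇ g v⟫_ℝ = fderiv ℝ f v 1 * fderiv ℝ g v 1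
      + fderiv ℝ f v Complex.I * fderiv ℝ g v Complex.I := by
  simp only [← inner_gradient_left, Complex.inner]
  simp
  ring

/-- Green's identity: the divergence of the vector field `f ∇g` is `⟪∇f, ∇g⟫ + f Δg`. -/
lemma setIntegral_inner_gradient {s : Set ℂ} (hs : Convex ℝ s) (hsc : IsCompact s) {f g : ℂ → ℝ}
    (hf : ContDiff ℝ 1 f) (hg : ContDiff ℝ 2 g) (hbdry : ∀ v ∈ frontier s, f v = 0) :
    ∫ v in s, ⟪∇ f v, ∇ g v⟫_ℝ = -∫ v in s, f v * Δ g v := by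
  have hg' (e : ℂ) : ContDiff ℝ 1 fun v => fderiv ℝ g v e :=
    (hg.fderiv_right (m := 1) (by norm_num)).clm_apply contDiff_const
  have hfg (e : ℂ) : ContDiff ℝ 1 fun v => f v * fderiv ℝ g v e := hf.mul (hg' e)
  have hzero (e : ℂ) := setIntegral_fderiv_apply_eq_zero (μ := volume) hs hsc (hfg e)
    (fun v hv => by rw [hbdry v hv, zero_mul]) e
  have hderiv (e v : ℂ) : fderiv ℝ (fun v => f v * fderiv ℝ g v e) v e
      = fderiv ℝ f v e * fderiv ℝ g v e + f v * fderiv ℝ (fun u => fderiv ℝ g u e) v e := by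
    rw [fderiv_fun_mul (hf.differentiable (by simp) v) ((hg' e).differentiable (by simp) v)]
    simp only [add_apply, smul_apply, smul_eq_mul]
    ring
  have hint {h : ℂ → ℝ} (hh : Continuous h) : IntegrableOn h s :=
    hh.continuousOn.integrableOn_compact hsc
  have hlap : Continuous fun v => f v * Δ g v := by
    simp only [laplacian_eq_fderiv_fderiv hg]
    exact hf.continuous.mul ((continuous_fderiv_apply (hg' _) _).add
      (continuous_fderiv_apply (hg' _) _))
  have hgrad : Continuous fun v => ⟪∇ f v, ∇ g v⟫_ℝ :=
    (continuous_gradient hf).inner (continuous_gradient (hg.of_le (by norm_num)))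
  rw [eq_neg_iff_add_eq_zero, ← integral_add (hint hgrad) (hint hlap)]
  calc ∫ v in s, ⟪∇ f v, ∇ g v⟫_ℝ + f v * Δ g v
      = ∫ v in s, fderiv ℝ (fun v => f v * fderiv ℝ g v 1) v 1
        + fderiv ℝ (fun v => f v * fderiv ℝ g v Complex.I) v Complex.I := by
        refine integral_congr_ae (Eventually.of_forall fun v => ?_)
        simp only [hderiv, inner_gradient_gradient, laplacian_eq_fderiv_fderiv hg]
        ring
    _ = 0 := by
        rw [integral_add (hint (continuous_fderiv_apply (hfg _) _))
          (hint (continuous_fderiv_apply (hfg _) _)), hzero, hzero, add_zero]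

/-- The closed unit disk, on which the Fourier-Bessel functions live. -/
abbrev unitDisk : Set ℂ := Metric.closedBall 0 1

lemma isCompact_unitDisk : IsCompact unitDisk := isCompact_closedBall _ _

lemma measurableSet_unitDisk : MeasurableSet unitDisk := isCompact_unitDisk.measurableSet

lemma mem_frontier_unitDisk {v : ℂ} : v ∈ frontier unitDisk ↔ ‖v‖ = 1 := by
  rw [frontier_closedBall _ one_ne_zero, mem_sphere_zero_iff_norm]

lemma integrableOn_unitDisk {f : ℂ → ℝ} (hf : Continuous f) : IntegrableOn f unitDisk :=
  hf.continuousOn.integrableOn_compact isCompact_unitDisk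

lemma setIntegral_sq_le_setIntegral_norm_gradient_sq {f : ℂ → ℝ} (hf : ContDiff ℝ 1 f)
    (hbdry : ∀ v ∈ frontier unitDisk, f v = 0) :
    ∫ v in unitDisk, f v ^ 2 ≤ ∫ v in unitDisk, ‖∇ f v‖ ^ 2 := by
  have hfield (L : ℂ →L[ℝ] ℝ) : ContDiff ℝ 1 fun v => L v * f v ^ 2 := L.contDiff.mul (hf.pow 2)
  have hzero (L : ℂ →L[ℝ] ℝ) (e : ℂ) := setIntegral_fderiv_apply_eq_zero (μ := volume)
    (convex_closedBall _ _) isCompact_unitDisk (hfield L) (fun v hv => by simp [hbdry v hv]) e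
  have hderiv (L : ℂ →L[ℝ] ℝ) (e v : ℂ) : fderiv ℝ (fun v => L v * f v ^ 2) v e
      = L e * f v ^ 2 + 2 * f v * (L v * fderiv ℝ f v e) := by
    have hfv := hf.differentiable (by simp) v
    rw [fderiv_fun_mul L.differentiableAt (hfv.fun_pow 2), fderiv_fun_pow 2 hfv, L.fderiv]
    simp
    ring
  have hcont (L : ℂ →L[ℝ] ℝ) (e : ℂ) :=
    integrableOn_unitDisk (continuous_fderiv_apply (hfield L) e)
  have hsq : IntegrableOn (fun v => f v ^ 2) unitDisk :=
    integrableOn_unitDisk (hf.continuous.pow 2)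
  have hgrad : IntegrableOn (fun v => ‖∇ f v‖ ^ 2) unitDisk :=
    integrableOn_unitDisk ((continuous_gradient hf).norm.pow 2)
  -- the divergence of the vector field `f(v)² v` is `2 f(v)² + 2 f(v) f'(v)v`
  have hdiv : 0 = ∫ v in unitDisk, fderiv ℝ (fun v => Complex.reCLM v * f v ^ 2) v 1
      + fderiv ℝ (fun v => Complex.imCLM v * f v ^ 2) v Complex.I := by
    rw [integral_add (hcont _ _) (hcont _ _), hzero, hzero, add_zero]
  rw [← sub_nonpos, ← integral_sub hsq hgrad, hdiv]
  refine setIntegral_mono_on (hsq.sub hgrad) ((hcont _ _).add (hcont _ _)) measurableSet_unitDisk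
    fun v hv => ?_
  have hsplit : fderiv ℝ f v v = v.re * fderiv ℝ f v 1 + v.im * fderiv ℝ f v Complex.I := by
    have hv : v = v.re • (1 : ℂ) + v.im • Complex.I := by simp
    simpa only [map_add, map_smul, smul_eq_mul] using congrArg (fderiv ℝ f v) hv
  have habs : |fderiv ℝ f v v| ≤ ‖∇ f v‖ := by
    rw [norm_gradient]
    exact (fderiv ℝ f v).unit_le_opNorm v (by simpa using hv)
  rw [hderiv, hderiv]
  calc f v ^ 2 - ‖∇ f v‖ ^ 2 ≤ f v ^ 2 - fderiv ℝ f v v ^ 2 :=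
        sub_le_sub_left (sq_le_sq.2 (habs.trans (le_abs_self _))) _
    _ ≤ 2 * f v ^ 2 + 2 * f v * fderiv ℝ f v v := by
        nlinarith only [sq_nonneg (f v + fderiv ℝ f v v)]
    _ = _ := by
        simp only [hsplit, Complex.reCLM_apply, Complex.imCLM_apply, Complex.one_re,
          Complex.I_im]
        ring

/-! ### Orthogonality of the Fourier-Bessel functions -/

lemma setIntegral_inner_gradient_fbSmooth (k k' : FBIndex) :
    ∫ v in unitDisk, ⟪∇ (fbSmooth k) v, ∇ (fbSmooth k') v⟫_ℝ
      = fbEigenvalue k' * ∫ v in unitDisk, fbSmooth k v * fbSmooth k' v := by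
  rw [setIntegral_inner_gradient (convex_closedBall _ _) isCompact_unitDisk
    ((contDiff_fbSmooth k).of_le (mod_cast le_top))
    (mod_cast contDiff_infty.1 (contDiff_fbSmooth k') 2)
    fun v hv => fbSmooth_eq_zero k (mem_frontier_unitDisk.1 hv), ← integral_neg,
    ← integral_const_mul]
  congr 1 with v
  rw [laplacian_fbSmooth]
  ring

lemma setIntegral_fbSmooth_mul (k k' : FBIndex) :
    ∫ v in unitDisk, fbSmooth k v * fbSmooth k' v = ∫ v, fbBasis k v * fbBasis k' v := by
  rw [← integral_indicator measurableSet_unitDisk]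
  simp only [fbBasis_eq_indicator, Set.indicator_mul]

lemma integral_fbBasis_mul (k k' : FBIndex) :
    ∫ v, fbBasis k v * fbBasis k' v
      = √(Real.pi / ∫ w, fbRaw k w ^ 2) * √(Real.pi / ∫ w, fbRaw k' w ^ 2)
        * ∫ v, fbRaw k v * fbRaw k' v := by
  rw [← integral_const_mul]
  congr 1 with v
  simp only [fbBasis]
  ring

lemma setIntegral_circleBasis_mul_of_ne {n n' : ℤ} (h : n ≠ n') :
    ∫ θ in Set.Ioo (-Real.pi) Real.pi, circleBasis n (θ : S1) * circleBasis n' (θ : S1) = 0 := by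
  have hcircle := AddCircle.integral_preimage (2 * Real.pi) (-Real.pi)
    fun β : S1 => circleBasis n β * circleBasis n' β
  rwa [AddCircle.volume_eq_smul_haarAddCircle, integral_smul_measure, integral_circleBasis_mul,
    if_neg h, smul_zero, show -Real.pi + 2 * Real.pi = Real.pi by ring,
    integral_Ioc_eq_integral_Ioo] at hcircle

lemma integral_fbRaw_mul_of_angular_ne {k k' : FBIndex} (h : k.1.1 ≠ k'.1.1) :
    ∫ v, fbRaw k v * fbRaw k' v = 0 := by
  have hprod := setIntegral_prod_mul (μ := (volume : Measure ℝ)) (ν := (volume : Measure ℝ))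
    (fun r => if r ≤ 1 then r * (besselJ k.1.1.natAbs (k.1.2 * r) *
      besselJ k'.1.1.natAbs (k'.1.2 * r)) else 0)
    (fun θ => circleBasis k.1.1 (θ : S1) * circleBasis k'.1.1 (θ : S1))
    (Set.Ioi 0) (Set.Ioo (-Real.pi) Real.pi)
  rw [setIntegral_circleBasis_mul_of_ne h, mul_zero, ← Measure.volume_eq_prod] at hprod
  rw [← Complex.integral_comp_polarCoord_symm, ← hprod]
  refine setIntegral_congr_fun (by measurability) fun p hp => ?_
  obtain ⟨hr, hθ⟩ := hp
  have harg : (Complex.polarCoord.symm p).arg = p.2 := by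
    rw [Complex.polarCoord_symm_apply]
    push_cast
    exact Complex.arg_mul_cos_add_sin_mul_I hr ⟨hθ.1, hθ.2.le⟩
  have hnorm : ‖Complex.polarCoord.symm p‖ = p.1 := by
    rw [Complex.norm_polarCoord_symm, abs_of_pos hr]
  simp only [fbRaw, harg, hnorm, smul_eq_mul]
  split_ifs <;> ring

lemma fbEigenvalue_nonneg (k : FBIndex) : 0 ≤ fbEigenvalue k := sq_nonneg _

lemma setIntegral_fbSmooth_mul_of_ne {k k' : FBIndex} (h : k ≠ k') :
    ∫ v in unitDisk, fbSmooth k v * fbSmooth k' v = 0 := by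
  by_cases hn : k.1.1 = k'.1.1
  · have hμ : fbEigenvalue k ≠ fbEigenvalue k' := fun hμ =>
      h (Subtype.ext (Prod.ext hn ((sq_eq_sq₀ k.2.1.le k'.2.1.le).1 hμ)))
    have hgreen := setIntegral_inner_gradient_fbSmooth k' k
    simp only [real_inner_comm (∇ (fbSmooth k) _), mul_comm (fbSmooth k' _),
      setIntegral_inner_gradient_fbSmooth k k'] at hgreen
    by_contra hne
    exact hμ (mul_right_cancel₀ hne hgreen.symm)
  · rw [setIntegral_fbSmooth_mul, integral_fbBasis_mul, integral_fbRaw_mul_of_angular_ne hn,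
      mul_zero]

/-- The integral is `π`, but if `fbRaw k` vanished identically `fbBasis k` would be `0`. -/
lemma setIntegral_fbSmooth_mul_self_le (k : FBIndex) :
    ∫ v in unitDisk, fbSmooth k v * fbSmooth k v ≤ Real.pi := by
  have hI : 0 ≤ ∫ w, fbRaw k w ^ 2 := integral_nonneg fun w => sq_nonneg _
  rw [setIntegral_fbSmooth_mul, integral_fbBasis_mul,
    Real.mul_self_sqrt (div_nonneg Real.pi_pos.le hI)]
  simp only [← sq]
  exact mul_le_of_le_div₀ Real.pi_pos.le hI le_rfl

/-! ### Finite Fourier-Bessel expansions -/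

/-- The measure `dβ dv` on `S¹ × {|v| ≤ 1}`, of total mass `π`. -/
abbrev cylinderMeasure : Measure (S1 × ℂ) := circleMeasure.prod (volume.restrict unitDisk)

instance : IsFiniteMeasure cylinderMeasure :=
  haveI : Fact (volume unitDisk < ∞) := ⟨isCompact_unitDisk.measure_lt_top⟩
  inferInstance

lemma integrable_cylinder {E : Type*} [NormedAddCommGroup E] {f : S1 × ℂ → E}
    (hf : Continuous f) : Integrable f cylinderMeasure := by
  have hrestrict : cylinderMeasure
      = ((circleMeasure).prod (volume : Measure ℂ)).restrict (Set.univ ×ˢ unitDisk) := by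
    rw [← Measure.prod_restrict, Measure.restrict_univ]
  rw [hrestrict]
  exact hf.continuousOn.integrableOn_compact (isCompact_univ.prod isCompact_unitDisk)

lemma cylinderMeasure_real_univ : cylinderMeasure.real Set.univ = Real.pi := by
  simp [Measure.real, ← Set.univ_prod_univ, Measure.prod_prod, Complex.volume_closedBall]

section General

variable {α : Type*} [MeasurableSpace α] {μ : Measure α}

lemma integral_norm_sum_sq_of_orthogonal {E ι : Type*} [NormedAddCommGroup E]
    [InnerProductSpace ℝ E] {s : Finset ι} {g : ι → α → E}
    (hint : ∀ i ∈ s, ∀ j ∈ s, Integrable (fun x => ⟪g i x, g j x⟫_ℝ) μ)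
    (horth : ∀ i ∈ s, ∀ j ∈ s, i ≠ j → ∫ x, ⟪g i x, g j x⟫_ℝ ∂μ = 0) :
    ∫ x, ‖∑ i ∈ s, g i x‖ ^ 2 ∂μ = ∑ i ∈ s, ∫ x, ⟪g i x, g i x⟫_ℝ ∂μ := by
  simp only [← real_inner_self_eq_norm_sq, sum_inner]
  simp only [inner_sum]
  rw [integral_finsetSum _ fun i hi => integrable_finsetSum _ (hint i hi)]
  refine Finset.sum_congr rfl fun i hi => ?_
  rw [integral_finsetSum _ (hint i hi)]
  exact Finset.sum_eq_single_of_mem i hi fun j hj hji => horth i hi j hj hji.symm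

lemma lintegral_enorm_le_sqrt [IsFiniteMeasure μ] {E : Type*} [NormedAddCommGroup E] {f : α → E}
    (hf : MemLp f 2 μ) :
    ∫⁻ x, ‖f x‖ₑ ∂μ ≤ ENNReal.ofReal √(μ.real Set.univ * ∫ x, ‖f x‖ ^ 2 ∂μ) := by
  have hsq : 0 ≤ ∫ x, ‖f x‖ ^ 2 ∂μ := integral_nonneg fun x => sq_nonneg _
  rw [← eLpNorm_one_eq_lintegral_enorm]
  refine (eLpNorm_le_eLpNorm_mul_rpow_measure_univ one_le_two hf.1).trans_eq ?_
  rw [hf.eLpNorm_eq_integral_rpow_norm two_ne_zero ENNReal.ofNat_ne_top, mul_comm (μ.real _),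
    Real.sqrt_mul hsq, ENNReal.ofReal_mul (Real.sqrt_nonneg _), Real.sqrt_eq_rpow,
    Real.sqrt_eq_rpow, ← ENNReal.ofReal_rpow_of_nonneg measureReal_nonneg (by norm_num),
    ofReal_measureReal]
  norm_num

end General

/-- `∑_{(k,m)∈s} a(k,m) ψ_k(v) φ_m(β)` with each `ψ_k` continued smoothly outside the disk. -/
def fbSum (s : Finset (FBIndex × ℤ)) (a : FBIndex × ℤ → ℝ) (β : S1) (v : ℂ) : ℝ :=
  ∑ q ∈ s, a q * circleBasis q.2 β * fbSmooth q.1 v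

/-- `∑_{(k,m)∈s} μ_k a(k,m)²`, the contribution of `s` to `‖a‖²_FB`. -/
def fbEnergy (s : Finset (FBIndex × ℤ)) (a : FBIndex × ℤ → ℝ) : ℝ :=
  ∑ q ∈ s, fbEigenvalue q.1 * a q ^ 2

section FbSum

variable (s : Finset (FBIndex × ℤ)) (a : FBIndex × ℤ → ℝ)

lemma contDiff_fbSum (β : S1) : ContDiff ℝ 1 (fbSum s a β) :=
  ContDiff.sum fun q _ => contDiff_const.mul ((contDiff_fbSmooth q.1).of_le (mod_cast le_top))

lemma fbSum_eq_zero (β : S1) {v : ℂ} (hv : ‖v‖ = 1) : fbSum s a β v = 0 :=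
  Finset.sum_eq_zero fun q _ => by rw [fbSmooth_eq_zero q.1 hv, mul_zero]

lemma gradient_fbSum (β : S1) (v : ℂ) :
    ∇ (fbSum s a β) v = ∑ q ∈ s, (a q * circleBasis q.2 β) • ∇ (fbSmooth q.1) v := by
  have hq (q : FBIndex × ℤ) : DifferentiableAt ℝ (fbSmooth q.1) v :=
    (contDiff_fbSmooth q.1).differentiable (by simp) v
  have hderiv : HasFDerivAt (fbSum s a β)
      (∑ q ∈ s, (a q * circleBasis q.2 β) • fderiv ℝ (fbSmooth q.1) v) v :=
    HasFDerivAt.fun_sum fun q _ => (hq q).hasFDerivAt.const_mul _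
  rw [gradient, hderiv.fderiv, map_sum]
  simp only [map_smulₛₗ, conj_trivial, gradient]

lemma continuous_fbSum : Continuous fun p : S1 × ℂ => fbSum s a p.1 p.2 :=
  continuous_finsetSum _ fun q _ => (continuous_const.mul
    ((continuous_circleBasis _).comp continuous_fst)).mul
    ((contDiff_fbSmooth q.1).continuous.comp continuous_snd)

lemma continuous_gradient_fbSmooth (k : FBIndex) : Continuous (∇ (fbSmooth k)) :=
  continuous_gradient ((contDiff_fbSmooth k).of_le (mod_cast le_top))

lemma continuous_gradient_fbSum : Continuous fun p : S1 × ℂ => ∇ (fbSum s a p.1) p.2 := by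
  simp only [gradient_fbSum]
  exact continuous_finsetSum _ fun q _ => (continuous_const.mul
    ((continuous_circleBasis _).comp continuous_fst)).smul
    ((continuous_gradient_fbSmooth q.1).comp continuous_snd)

lemma integral_norm_gradient_fbSum_sq_le :
    ∫ p, ‖∇ (fbSum s a p.1) p.2‖ ^ 2 ∂cylinderMeasure ≤ Real.pi * fbEnergy s a := by
  have hcont (q : FBIndex × ℤ) :
      Continuous fun p : S1 × ℂ => (a q * circleBasis q.2 p.1) • ∇ (fbSmooth q.1) p.2 :=
    (continuous_const.mul ((continuous_circleBasis _).comp continuous_fst)).smul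
      ((continuous_gradient_fbSmooth q.1).comp continuous_snd)
  have hinner (q q' : FBIndex × ℤ) :
      ∫ p, ⟪(a q * circleBasis q.2 p.1) • ∇ (fbSmooth q.1) p.2,
        (a q' * circleBasis q'.2 p.1) • ∇ (fbSmooth q'.1) p.2⟫_ℝ ∂cylinderMeasure
      = (a q * a q' * if q.2 = q'.2 then 1 else 0)
        * (fbEigenvalue q'.1 * ∫ v in unitDisk, fbSmooth q.1 v * fbSmooth q'.1 v) := by
    rw [← integral_circleBasis_mul, ← integral_const_mul, ← setIntegral_inner_gradient_fbSmooth,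
      ← integral_prod_mul]
    congr 1 with p
    rw [real_inner_smul_left, real_inner_smul_right]
    ring
  simp only [gradient_fbSum]
  rw [integral_norm_sum_sq_of_orthogonal
    (fun q _ q' _ => integrable_cylinder ((hcont q).inner (hcont q'))), fbEnergy, Finset.mul_sum]
  · refine Finset.sum_le_sum fun q _ => ?_
    have hμ : 0 ≤ fbEigenvalue q.1 * a q ^ 2 := mul_nonneg (fbEigenvalue_nonneg _) (sq_nonneg _)
    rw [hinner, if_pos rfl]
    linarith [mul_le_mul_of_nonneg_left (setIntegral_fbSmooth_mul_self_le q.1) hμ]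
  · intro q _ q' _ hne
    rw [hinner]
    split_ifs with h
    · rw [setIntegral_fbSmooth_mul_of_ne fun hk => hne (Prod.ext hk h), mul_zero, mul_zero]
    · rw [mul_zero, zero_mul]

lemma integral_norm_fbSum_sq_le :
    ∫ p, ‖fbSum s a p.1 p.2‖ ^ 2 ∂cylinderMeasure ≤ Real.pi * fbEnergy s a := by
  have hsq : Integrable (fun p : S1 × ℂ => ‖fbSum s a p.1 p.2‖ ^ 2) cylinderMeasure :=
    integrable_cylinder ((continuous_fbSum s a).norm.pow 2)
  have hgrad : Integrable (fun p : S1 × ℂ => ‖∇ (fbSum s a p.1) p.2‖ ^ 2) cylinderMeasure :=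
    integrable_cylinder ((continuous_gradient_fbSum s a).norm.pow 2)
  refine le_trans ?_ (integral_norm_gradient_fbSum_sq_le s a)
  rw [integral_prod _ hsq, integral_prod _ hgrad]
  refine integral_mono hsq.integral_prod_left hgrad.integral_prod_left fun β => ?_
  simp only [Real.norm_eq_abs, sq_abs]
  exact setIntegral_sq_le_setIntegral_norm_gradient_sq (contDiff_fbSum s a β)
    fun v hv => fbSum_eq_zero s a β (mem_frontier_unitDisk.1 hv)

lemma lintegral_enorm_cylinder_le {E : Type*} [NormedAddCommGroup E] {f : S1 → ℂ → E}
    (hf : Continuous fun p : S1 × ℂ => f p.1 p.2) {T : ℝ}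
    (hT : ∫ p, ‖f p.1 p.2‖ ^ 2 ∂cylinderMeasure ≤ Real.pi * T) :
    ∫⁻ β, (∫⁻ v in unitDisk, ‖f β v‖ₑ) ∂circleMeasure ≤ ENNReal.ofReal (Real.pi * √T) := by
  have hmeas := (integrable_cylinder hf).aestronglyMeasurable
  have hmem : MemLp (fun p : S1 × ℂ => f p.1 p.2) 2 cylinderMeasure :=
    (memLp_two_iff_integrable_sq_norm hmeas).2 (integrable_cylinder (hf.norm.pow 2))
  rw [← lintegral_prod _ hmeas.enorm]
  refine (lintegral_enorm_le_sqrt hmem).trans (ENNReal.ofReal_le_ofReal ?_)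
  rw [cylinderMeasure_real_univ]
  calc √(Real.pi * ∫ p, ‖f p.1 p.2‖ ^ 2 ∂cylinderMeasure) ≤ √(Real.pi * (Real.pi * T)) := by gcongr
    _ = Real.pi * √T := by
        rw [← mul_assoc, Real.sqrt_mul (mul_self_nonneg _), Real.sqrt_mul_self Real.pi_pos.le]

lemma lintegral_enorm_fbSum_le :
    ∫⁻ β, (∫⁻ v in unitDisk, ‖fbSum s a β v‖ₑ) ∂circleMeasure
      ≤ ENNReal.ofReal (Real.pi * √(fbEnergy s a)) :=
  lintegral_enorm_cylinder_le (continuous_fbSum s a) (integral_norm_fbSum_sq_le s a)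

lemma lintegral_enorm_fderiv_fbSum_le :
    ∫⁻ β, (∫⁻ v in unitDisk, ‖fderiv ℝ (fbSum s a β) v‖ₑ) ∂circleMeasure
      ≤ ENNReal.ofReal (Real.pi * √(fbEnergy s a)) := by
  simp only [← ofReal_norm, ← norm_gradient]
  simp only [ofReal_norm]
  exact lintegral_enorm_cylinder_le (continuous_gradient_fbSum s a)
    (integral_norm_gradient_fbSum_sq_le s a)

end FbSum

/-! ### Contractive displacement fields -/

lemma det_complex (A : ℂ →L[ℝ] ℂ) :
    A.det = (A 1).re * (A Complex.I).im - (A Complex.I).re * (A 1).im := by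
  rw [ContinuousLinearMap.det, ← LinearMap.det_toMatrix Complex.basisOneI, Matrix.det_fin_two]
  simp [LinearMap.toMatrix_apply]

lemma abs_det_id_sub_sub_one_le {A : ℂ →L[ℝ] ℂ} {ε : ℝ} (hA : ‖A‖ ≤ ε) :
    |(ContinuousLinearMap.id ℝ ℂ - A).det - 1| ≤ 2 * ε + ε ^ 2 := by
  have hone : ‖A 1‖ ≤ ε := by simpa using A.le_of_opNorm_le hA 1
  have hI : ‖A Complex.I‖ ≤ ε := by simpa using A.le_of_opNorm_le hA Complex.I
  have htrace : |(A 1).re + (A Complex.I).im| ≤ ε + ε :=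
    (abs_add_le _ _).trans (add_le_add ((Complex.abs_re_le_norm _).trans hone)
      ((Complex.abs_im_le_norm _).trans hI))
  -- the determinant is `Im (conj (A 1) * A I)`
  have hdet : |A.det| ≤ ε ^ 2 := by
    have him : A.det = (star (A 1) * A Complex.I).im := by
      rw [det_complex]
      simp only [RCLike.star_def, Complex.mul_im, Complex.conj_re, Complex.conj_im]
      ring
    rw [him, sq]
    refine (Complex.abs_im_le_norm _).trans ?_
    rw [norm_mul, norm_star]
    exact mul_le_mul hone hI (norm_nonneg _) ((norm_nonneg _).trans hone)
  have hexpand : (ContinuousLinearMap.id ℝ ℂ - A).det - 1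
      = A.det - ((A 1).re + (A Complex.I).im) := by
    simp only [det_complex, sub_apply, ContinuousLinearMap.id_apply, Complex.sub_re,
      Complex.sub_im, Complex.one_re, Complex.one_im, Complex.I_re, Complex.I_im]
    ring
  rw [hexpand]
  linarith [abs_sub A.det ((A 1).re + (A Complex.I).im)]

lemma sq_le_abs_det {A : ℂ →L[ℝ] ℂ} {c : ℝ} (hc : 0 ≤ c) (hA : ∀ v, c * ‖v‖ ≤ ‖A v‖) :
    c ^ 2 ≤ |A.det| := by
  obtain rfl | hc := hc.eq_or_lt
  · simp
  set E := (A 1).re ^ 2 + (A 1).im ^ 2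
  set F := (A 1).re * (A Complex.I).re + (A 1).im * (A Complex.I).im
  have hsq (v : ℂ) : c ^ 2 * (v.re ^ 2 + v.im ^ 2) ≤ (A v).re ^ 2 + (A v).im ^ 2 := by
    have h := pow_le_pow_left₀ (by positivity) (hA v) 2
    rw [mul_pow, ← Complex.normSq_eq_norm_sq, ← Complex.normSq_eq_norm_sq, Complex.normSq_apply,
      Complex.normSq_apply] at h
    linarith
  have hE_le : c ^ 2 ≤ E := by simpa using hsq 1
  -- `A w` is orthogonal to `A 1`, so `‖A w‖² = E · det²`
  set w : ℂ := ⟨-F, E⟩ with hw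
  have hAw : A w = (-F : ℝ) • A 1 + E • A Complex.I := by
    rw [← map_smul, ← map_smul, ← map_add]
    congr 1
    apply Complex.ext <;> simp [hw]
  have hdet : c ^ 2 * (F ^ 2 + E ^ 2) ≤ E * A.det ^ 2 := by
    have h := hsq w
    rw [hAw] at h
    simp only [Complex.add_re, Complex.add_im, Complex.smul_re, Complex.smul_im, smul_eq_mul,
      hw] at h
    rw [det_complex]
    linear_combination h
  have hpos : 0 < E := (pow_pos hc 2).trans_le hE_le
  have hdet_sq : (c ^ 2) ^ 2 ≤ A.det ^ 2 := by
    have : E * (c ^ 2 * E) ≤ E * A.det ^ 2 := by nlinarith [sq_nonneg (c * F)]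
    nlinarith [le_of_mul_le_mul_left this hpos, sq_nonneg c]
  simpa using sq_le_sq.1 hdet_sq

/-- A displacement field `τ` of the plane with `|∇τ|_∞ ≤ ε < 1`; the deformation of the plane that
belongs to it is `u ↦ u - τ u`. -/
structure ContractiveField (τ : ℂ → ℂ) (ε : ℝ) : Prop where
  differentiable : Differentiable ℝ τ
  norm_fderiv_le : ∀ u, ‖fderiv ℝ τ u‖ ≤ ε
  lt_one : ε < 1

/-- The Jacobian `|det (1 - ∇τ(u))|` of the deformation `u ↦ u - τ u`. -/
def jacobian (τ : ℂ → ℂ) (u : ℂ) : ℝ := |(ContinuousLinearMap.id ℝ ℂ - fderiv ℝ τ u).det|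

namespace ContractiveField

variable {τ : ℂ → ℂ} {ε : ℝ}

lemma nonneg (h : ContractiveField τ ε) : 0 ≤ ε := (norm_nonneg _).trans (h.norm_fderiv_le 0)

lemma one_sub_pos (h : ContractiveField τ ε) : 0 < 1 - ε := sub_pos.2 h.lt_one

lemma smul (h : ContractiveField τ ε) {s : ℝ} (hs0 : 0 ≤ s) (hs1 : s ≤ 1) :
    ContractiveField (fun u => s • τ u) ε where
  differentiable := h.differentiable.const_smul s
  norm_fderiv_le u := by
    rw [fderiv_fun_const_smul (h.differentiable u), norm_smul, Real.norm_of_nonneg hs0]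
    exact (mul_le_of_le_one_left (norm_nonneg _) hs1).trans (h.norm_fderiv_le u)
  lt_one := h.lt_one

lemma norm_sub_le (h : ContractiveField τ ε) (z u : ℂ) : ‖τ z - τ u‖ ≤ ε * ‖z - u‖ :=
  Convex.norm_image_sub_le_of_norm_fderiv_le (fun z _ => h.differentiable z)
    (fun z _ => h.norm_fderiv_le z) convex_univ (Set.mem_univ u) (Set.mem_univ z)

lemma hasFDerivAt (h : ContractiveField τ ε) (u : ℂ) :
    HasFDerivAt (fun u => u - τ u) (ContinuousLinearMap.id ℝ ℂ - fderiv ℝ τ u) u :=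
  (hasFDerivAt_id u).sub (h.differentiable u).hasFDerivAt

lemma abs_jacobian_sub_one_le (h : ContractiveField τ ε) (u : ℂ) :
    |jacobian τ u - 1| ≤ 2 * ε + ε ^ 2 := by
  simpa only [jacobian, abs_one] using
    (abs_abs_sub_abs_le _ 1).trans (abs_det_id_sub_sub_one_le (h.norm_fderiv_le u))

lemma jacobian_le (h : ContractiveField τ ε) (u : ℂ) : jacobian τ u ≤ (1 + ε) ^ 2 := by
  linarith [(abs_le.1 (h.abs_jacobian_sub_one_le u)).2]

lemma sq_le_jacobian (h : ContractiveField τ ε) (u : ℂ) : (1 - ε) ^ 2 ≤ jacobian τ u := by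
  refine sq_le_abs_det h.one_sub_pos.le fun v => ?_
  have hv := (fderiv ℝ τ u).le_of_opNorm_le (h.norm_fderiv_le u) v
  have hsub := norm_sub_norm_le v (fderiv ℝ τ u v)
  rw [sub_apply, ContinuousLinearMap.id_apply]
  linarith

lemma le_norm_deform_sub (h : ContractiveField τ ε) (z u : ℂ) :
    (1 - ε) * ‖z - u‖ ≤ ‖(z - τ z) - (u - τ u)‖ := by
  have hsub := norm_sub_norm_le (z - u) (τ z - τ u)
  rw [sub_sub_sub_comm] at hsub
  linarith [h.norm_sub_le z u]

lemma injective (h : ContractiveField τ ε) : Function.Injective fun u => u - τ u := by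
  intro z u (hzu : z - τ z = u - τ u)
  have hle := h.le_norm_deform_sub z u
  rw [hzu, sub_self, norm_zero] at hle
  exact sub_eq_zero.1 (norm_le_zero_iff.1 (nonpos_of_mul_nonpos_right hle h.one_sub_pos))

lemma surjective (h : ContractiveField τ ε) : Function.Surjective fun u => u - τ u := by
  intro y
  have hcontr : ContractingWith ⟨ε, h.nonneg⟩ fun z => y + τ z := by
    refine ⟨NNReal.coe_lt_coe.1 h.lt_one, LipschitzWith.of_dist_le_mul fun z u => ?_⟩
    rw [dist_eq_norm, dist_eq_norm, add_sub_add_left_eq_sub]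
    exact h.norm_sub_le z u
  exact ⟨hcontr.fixedPoint, sub_eq_of_eq_add hcontr.fixedPoint_isFixedPt.symm⟩

lemma measurableEmbedding (h : ContractiveField τ ε) : MeasurableEmbedding fun u => u - τ u :=
  (continuous_id.sub h.differentiable.continuous).measurableEmbedding h.injective

lemma lintegral_jacobian_mul (h : ContractiveField τ ε) (G : ℂ → ℝ≥0∞) :
    ∫⁻ u, ENNReal.ofReal (jacobian τ u) * G (u - τ u) = ∫⁻ u, G u := by
  have hcov := lintegral_image_eq_lintegral_abs_det_fderiv_mul volume MeasurableSet.univ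
    (fun u _ => (h.hasFDerivAt u).hasFDerivWithinAt) h.injective.injOn G
  rw [Set.image_univ, h.surjective.range_eq] at hcov
  simpa only [jacobian, Measure.restrict_univ] using hcov.symm

lemma lintegral_comp_le (h : ContractiveField τ ε) (G : ℂ → ℝ≥0∞) :
    ∫⁻ u, G (u - τ u) ≤ ENNReal.ofReal ((1 - ε)⁻¹ ^ 2) * ∫⁻ u, G u := by
  rw [← h.lintegral_jacobian_mul G, ← lintegral_const_mul' _ _ ENNReal.ofReal_ne_top]
  refine lintegral_mono fun u => ?_
  beta_reduce
  rw [← mul_assoc, ← ENNReal.ofReal_mul (sq_nonneg _)]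
  refine le_mul_of_one_le_left' (ENNReal.one_le_ofReal.2 ?_)
  rw [inv_pow, ← div_eq_inv_mul]
  exact (one_le_div (pow_pos h.one_sub_pos 2)).2 (h.sq_le_jacobian u)

end ContractiveField

lemma lintegral_comp_mul_left_complex {c : ℂ} (hc : c ≠ 0) (G : ℂ → ℝ≥0∞) :
    ENNReal.ofReal (‖c‖ ^ 2) * ∫⁻ u, G (c * u) = ∫⁻ u, G u := by
  have hcov := lintegral_image_eq_lintegral_abs_det_fderiv_mul volume MeasurableSet.univ
    (fun u _ => (ContinuousLinearMap.mul ℝ ℂ c).hasFDerivAt.hasFDerivWithinAt (x := u))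
    (mul_right_injective₀ hc).injOn G
  have hsurj : Function.Surjective (ContinuousLinearMap.mul ℝ ℂ c) := mul_left_surjective₀ hc
  rw [Set.image_univ, hsurj.range_eq] at hcov
  have hdet : |(ContinuousLinearMap.mul ℝ ℂ c).det| = ‖c‖ ^ 2 := by
    rw [← Complex.normSq_eq_norm_sq, ← Algebra.norm_complex_apply, Algebra.norm_apply, eq_comm]
    exact (abs_of_nonneg (Algebra.norm_complex_apply c ▸ Complex.normSq_nonneg c)).symm
  rw [← lintegral_const_mul' _ _ ENNReal.ofReal_ne_top, ← hdet]
  simpa using hcov.symm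

lemma ContractiveField.lintegral_comp_mul_sub_deform_le {τ : ℂ → ℂ} {ε : ℝ}
    (h : ContractiveField τ ε) {c : ℂ} (hc : c ≠ 0) (z : ℂ) (G : ℂ → ℝ≥0∞) :
    ENNReal.ofReal (‖c‖ ^ 2) * ∫⁻ u, G (c * (z - (u - τ u)))
      ≤ ENNReal.ofReal ((1 - ε)⁻¹ ^ 2) * ∫⁻ u, G u := by
  rw [← lintegral_comp_mul_left_complex hc G, mul_left_comm]
  gcongr
  refine (h.lintegral_comp_le fun u => G (c * (z - u))).trans_eq ?_
  rw [lintegral_sub_left_eq_self (fun u => G (c * u)) z]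

/-! ### Increments of functions supported in the disk -/

lemma finite_setOf_norm_add_smul_eq {E : Type*} [NormedAddCommGroup E] [InnerProductSpace ℝ E]
    (a : E) {d : E} (hd : d ≠ 0) (r : ℝ) : {s : ℝ | ‖a + s • d‖ = r}.Finite := by
  obtain hempty | ⟨s₁, hs₁⟩ := {s : ℝ | ‖a + s • d‖ = r}.eq_empty_or_nonempty
  · exact hempty ▸ Set.finite_empty
  have hquad {s : ℝ} (hs : ‖a + s • d‖ = r) :
      ‖a‖ ^ 2 + 2 * (s * inner ℝ a d) + s ^ 2 * ‖d‖ ^ 2 = r ^ 2 := by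
    rw [← hs, norm_add_sq_real, real_inner_smul_right, norm_smul, mul_pow, Real.norm_eq_abs,
      sq_abs]
  refine (Set.toFinite {s₁, -s₁ - 2 * inner ℝ a d / ‖d‖ ^ 2}).subset fun s hs => ?_
  have hfactor : (s - s₁) * ((s + s₁) * ‖d‖ ^ 2 + 2 * inner ℝ a d) = 0 := by
    linear_combination hquad hs - hquad hs₁
  refine (mul_eq_zero.1 hfactor).imp sub_eq_zero.1 fun h => ?_
  rw [Set.mem_singleton_iff, eq_sub_iff_add_eq, eq_neg_iff_add_eq_zero]
  field_simp [norm_ne_zero_iff.2 hd]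
  linear_combination h

lemma enorm_indicator_sub_le {E : Type*} [NormedAddCommGroup E] [NormedSpace ℝ E] {K : Set E}
    (hK : IsClosed K) {S : E → ℝ} (hS : ContDiff ℝ 1 S) (hbdry : ∀ v ∈ frontier K, S v = 0)
    {a d : E} (hline : {s : ℝ | a + s • d ∈ frontier K}.Countable) :
    ‖K.indicator S (a + d) - K.indicator S a‖ₑ
      ≤ ∫⁻ s : ℝ in Set.Icc 0 1, K.indicator (fun v => ‖fderiv ℝ S v‖ₑ) (a + s • d) * ‖d‖ₑ := by
  have hcont : Continuous fun s : ℝ => a + s • d := by fun_prop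
  have hderiv {s : ℝ} (hs : a + s • d ∉ frontier K) : HasDerivAt
      (fun s : ℝ => K.indicator S (a + s • d)) (K.indicator (fderiv ℝ S) (a + s • d) d) s := by
    have hline : HasDerivAt (fun s : ℝ => a + s • d) d s := by
      simpa using ((hasDerivAt_id s).smul_const d).const_add a
    exact (hasFDerivAt_indicator (hS.differentiable (by simp) _) hs).comp_hasDerivAt s hline
  have hint : IntegrableOn ((fun s : ℝ => a + s • d) ⁻¹' K |>.indicator
      fun s => fderiv ℝ S (a + s • d) d) (Set.Icc 0 1) :=
    (((hS.continuous_fderiv (by simp)).comp hcont).clm_apply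
      continuous_const).continuousOn.integrableOn_Icc.indicator (hK.preimage hcont).measurableSet
  have hind (s : ℝ) : K.indicator (fderiv ℝ S) (a + s • d) d
      = ((fun s : ℝ => a + s • d) ⁻¹' K).indicator (fun s => fderiv ℝ S (a + s • d) d) s := by
    by_cases hs : a + s • d ∈ K <;> simp [hs]
  have hftc := integral_eq_of_hasDerivAt_off_countable
    (fun s : ℝ => K.indicator S (a + s • d)) (fun s => K.indicator (fderiv ℝ S) (a + s • d) d) hline
    ((continuous_indicator hbdry hS.continuous.continuousOn).comp hcont).continuousOn
    (fun s hs => hderiv hs.2) ((intervalIntegrable_iff_integrableOn_Icc_of_le zero_le_one).2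
        (by simpa only [hind] using hint))
  simp only [one_smul, zero_smul, add_zero] at hftc
  rw [← hftc, intervalIntegral.integral_of_le zero_le_one, ← integral_Icc_eq_integral_Ioc]
  refine (enorm_integral_le_lintegral_enorm _).trans (lintegral_mono fun s => ?_)
  by_cases hs : a + s • d ∈ K
  · simpa only [Set.indicator_of_mem hs] using ContinuousLinearMap.le_opENorm _ _
  · simp [hs]

lemma enorm_indicator_unitDisk_sub_le {S : ℂ → ℝ} (hS : ContDiff ℝ 1 S)
    (hbdry : ∀ v : ℂ, ‖v‖ = 1 → S v = 0) (a d : ℂ) :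
    ‖unitDisk.indicator S (a + d) - unitDisk.indicator S a‖ₑ ≤ ∫⁻ s : ℝ in Set.Icc 0 1,
      unitDisk.indicator (fun v => ‖fderiv ℝ S v‖ₑ) (a + s • d) * ‖d‖ₑ := by
  obtain rfl | hd := eq_or_ne d 0
  · simp
  refine enorm_indicator_sub_le isCompact_unitDisk.isClosed hS
    (fun v hv => hbdry v (mem_frontier_unitDisk.1 hv)) ?_
  simpa only [mem_frontier_unitDisk] using (finite_setOf_norm_add_smul_eq a hd 1).countable

namespace ContractiveField

variable {τ : ℂ → ℂ} {ε : ℝ} {S : ℂ → ℝ}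

lemma norm_sub_le_mul_norm_deform_sub (h : ContractiveField τ ε) {s : ℝ} (hs : s ∈ Set.Icc 0 1)
    (z u : ℂ) : ‖τ z - τ u‖ ≤ ε * (1 - ε)⁻¹ * ‖(z - s • τ z) - (u - s • τ u)‖ := by
  have hle := (h.smul hs.1 hs.2).le_norm_deform_sub z u
  rw [mul_assoc]
  refine (h.norm_sub_le z u).trans (mul_le_mul_of_nonneg_left ?_ h.nonneg)
  rwa [← div_eq_inv_mul, le_div_iff₀' h.one_sub_pos]

lemma enorm_indicator_deform_sub_le (h : ContractiveField τ ε) (hS : ContDiff ℝ 1 S)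
    (hbdry : ∀ v : ℂ, ‖v‖ = 1 → S v = 0) (c z u : ℂ) :
    ‖unitDisk.indicator S (c * ((z - τ z) - (u - τ u))) - unitDisk.indicator S (c * (z - u))‖ₑ
      ≤ ∫⁻ s : ℝ in Set.Icc 0 1, ENNReal.ofReal (ε * (1 - ε)⁻¹) *
        unitDisk.indicator (fun v => ‖fderiv ℝ S v‖ₑ) (c * ((z - s • τ z) - (u - s • τ u))) := by
  have hpath (s : ℝ) : c * (z - u) + s • -(c * (τ z - τ u))
      = c * ((z - s • τ z) - (u - s • τ u)) := by
    simp only [Complex.real_smul]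
    ring
  have hend : c * (z - u) + -(c * (τ z - τ u)) = c * ((z - τ z) - (u - τ u)) := by ring
  have hincr := enorm_indicator_unitDisk_sub_le hS hbdry (c * (z - u)) (-(c * (τ z - τ u)))
  simp only [hpath, hend] at hincr
  refine hincr.trans (setLIntegral_mono' measurableSet_Icc fun s hs => ?_)
  by_cases hm : c * ((z - s • τ z) - (u - s • τ u)) ∈ unitDisk
  · rw [mul_comm, ← ofReal_norm]
    gcongr
    rw [mem_closedBall_zero_iff, norm_mul] at hm
    rw [norm_neg, norm_mul]
    calc ‖c‖ * ‖τ z - τ u‖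
        ≤ ‖c‖ * (ε * (1 - ε)⁻¹ * ‖(z - s • τ z) - (u - s • τ u)‖) := by
          gcongr
          exact h.norm_sub_le_mul_norm_deform_sub hs z u
      _ = ε * (1 - ε)⁻¹ * (‖c‖ * ‖(z - s • τ z) - (u - s • τ u)‖) := by ring
      _ ≤ ε * (1 - ε)⁻¹ :=
          mul_le_of_le_one_right (mul_nonneg h.nonneg (inv_nonneg.2 h.one_sub_pos.le)) hm
  · simp only [Set.indicator_of_notMem hm, zero_mul, mul_zero, le_refl]

lemma lintegral_enorm_indicator_deform_sub_le (h : ContractiveField τ ε) (hS : ContDiff ℝ 1 S)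
    (hbdry : ∀ v : ℂ, ‖v‖ = 1 → S v = 0) {c : ℂ} (hc : c ≠ 0) (z : ℂ) :
    ENNReal.ofReal (‖c‖ ^ 2) * ∫⁻ u, ‖unitDisk.indicator S (c * ((z - τ z) - (u - τ u)))
        - unitDisk.indicator S (c * (z - u))‖ₑ
      ≤ ENNReal.ofReal (ε * (1 - ε)⁻¹ ^ 3) * ∫⁻ v in unitDisk, ‖fderiv ℝ S v‖ₑ := by
  set g : ℂ → ℝ≥0∞ := unitDisk.indicator fun v => ‖fderiv ℝ S v‖ₑ
  have hg : Measurable g :=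
    (hS.continuous_fderiv (by simp)).enorm.measurable.indicator measurableSet_unitDisk
  have hpath : Continuous fun p : ℂ × ℝ => c * ((z - p.2 • τ z) - (p.1 - p.2 • τ p.1)) := by
    have := h.differentiable.continuous
    fun_prop
  have hconst : ε * (1 - ε)⁻¹ ^ 3 = ε * (1 - ε)⁻¹ * (1 - ε)⁻¹ ^ 2 := by ring
  calc _ ≤ ENNReal.ofReal (‖c‖ ^ 2) * ∫⁻ u, ∫⁻ s : ℝ in Set.Icc 0 1,
        ENNReal.ofReal (ε * (1 - ε)⁻¹) * g (c * ((z - s • τ z) - (u - s • τ u))) := by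
        gcongr with u
        exact h.enorm_indicator_deform_sub_le hS hbdry c z u
    _ = ENNReal.ofReal (ε * (1 - ε)⁻¹) * ∫⁻ s : ℝ in Set.Icc 0 1,
        ENNReal.ofReal (‖c‖ ^ 2) * ∫⁻ u, g (c * ((z - s • τ z) - (u - s • τ u))) := by
        rw [lintegral_lintegral_swap ((hg.comp hpath.measurable).const_mul _).aemeasurable]
        simp only [lintegral_const_mul' _ _ ENNReal.ofReal_ne_top]
        exact mul_left_comm _ _ _
    _ ≤ ENNReal.ofReal (ε * (1 - ε)⁻¹) * ∫⁻ _ in Set.Icc (0 : ℝ) 1,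
        ENNReal.ofReal ((1 - ε)⁻¹ ^ 2) * ∫⁻ v, g v := by
        gcongr 1
        exact setLIntegral_mono' measurableSet_Icc fun s hs =>
          (h.smul hs.1 hs.2).lintegral_comp_mul_sub_deform_le hc (z - s • τ z) g
    _ = _ := by
        rw [hconst, ENNReal.ofReal_mul (mul_nonneg h.nonneg (inv_nonneg.2 h.one_sub_pos.le)),
          ← lintegral_indicator measurableSet_unitDisk]
        simp [g, mul_assoc]

end ContractiveField

/-! ### Integral bounds for filters -/

/-- The `L¹` distance between the filter `W` placed at `z` and its composition with the deformation
`u ↦ u - τ u`, where the slice of `W` at the angle `β` is rotated by the unit number `c β`. -/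
def deformDefect (τ : ℂ → ℂ) (c : S1 → ℂ) (z : ℂ) (W : ℂ × S1 → ℝ) : ℝ≥0∞ :=
  ∫⁻ β, (∫⁻ u, ‖W (c β * ((z - τ z) - (u - τ u)), β) - W (c β * (z - u), β)‖ₑ) ∂circleMeasure

/-- The filter `W` is measurable, and `κ` bounds the `L¹` norm of `W` and, up to a factor of order
`ε`, the effect on `W` of deforming the plane. -/
structure IsDeformationBound (τ : ℂ → ℂ) (ε : ℝ) (W : ℂ × S1 → ℝ) (κ : ℝ≥0∞) : Prop where
  measurable : Measurable W
  norm_le : ∫⁻ p, ‖W p‖ₑ ∂jointMeasure ≤ κ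
  deform_le : ∀ c : S1 → ℂ, Measurable c → (∀ β, ‖c β‖ = 1) → ∀ z,
    deformDefect τ c z W ≤ ENNReal.ofReal (ε * (1 - ε)⁻¹ ^ 3) * κ

section Approximation

variable {τ : ℂ → ℂ} {ε : ℝ} {c : S1 → ℂ} {V W : ℂ × S1 → ℝ}

lemma measurable_rotated (hc : Measurable c) {θ : ℂ → ℂ} (hθ : Measurable θ) (z : ℂ)
    (hW : Measurable W) : Measurable fun p : S1 × ℂ => W (c p.1 * (z - θ p.2), p.1) := by
  fun_prop

lemma deformDefect_le_add (hτ : Measurable τ) (hc : Measurable c) (z : ℂ)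
    (hV : Measurable V) :
    deformDefect τ c z W ≤ deformDefect τ c z V + deformDefect τ c z fun p => W p - V p := by
  have hdefect : Measurable fun p : S1 × ℂ =>
      ‖V (c p.1 * ((z - τ z) - (p.2 - τ p.2)), p.1) - V (c p.1 * (z - p.2), p.1)‖ₑ :=
    ((measurable_rotated hc (measurable_id.sub hτ) _ hV).sub
      (measurable_rotated hc measurable_id z hV)).enorm
  have hslice (β : S1) : Measurable fun u =>
      ‖V (c β * ((z - τ z) - (u - τ u)), β) - V (c β * (z - u), β)‖ₑ :=
    hdefect.comp measurable_prodMk_left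
  simp only [deformDefect]
  rw [← lintegral_add_left hdefect.lintegral_prod_right']
  refine lintegral_mono fun β => ?_
  dsimp only
  rw [← lintegral_add_left (hslice β)]
  refine lintegral_mono fun u => (enorm_add_le _ _).trans_eq' ?_
  congr 1
  ring

lemma deformDefect_le (h : ContractiveField τ ε) (hc : Measurable c) (hc1 : ∀ β, ‖c β‖ = 1) (z : ℂ)
    (hW : Measurable W) :
    deformDefect τ c z W
      ≤ (ENNReal.ofReal ((1 - ε)⁻¹ ^ 2) + 1) * ∫⁻ p, ‖W p‖ₑ ∂jointMeasure := by
  have hc0 (β : S1) : c β ≠ 0 := norm_ne_zero_iff.1 (by simp [hc1])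
  have hdeformed (β : S1) : ∫⁻ u, ‖W (c β * ((z - τ z) - (u - τ u)), β)‖ₑ
      ≤ ENNReal.ofReal ((1 - ε)⁻¹ ^ 2) * ∫⁻ v, ‖W (v, β)‖ₑ := by
    simpa [hc1] using
      h.lintegral_comp_mul_sub_deform_le (hc0 β) (z - τ z) fun v => ‖W (v, β)‖ₑ
  have hrotated (β : S1) : ∫⁻ u, ‖W (c β * (z - u), β)‖ₑ = ∫⁻ v, ‖W (v, β)‖ₑ := by
    rw [lintegral_sub_left_eq_self (fun u => ‖W (c β * u, β)‖ₑ) z]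
    simpa [hc1] using lintegral_comp_mul_left_complex (hc0 β) fun v => ‖W (v, β)‖ₑ
  rw [lintegral_prod_symm _ hW.enorm.aemeasurable,
    ← lintegral_const_mul' _ _ (by finiteness), deformDefect]
  refine lintegral_mono fun β => ?_
  calc _ ≤ ∫⁻ u, (‖W (c β * ((z - τ z) - (u - τ u)), β)‖ₑ + ‖W (c β * (z - u), β)‖ₑ) :=
        lintegral_mono fun u => enorm_sub_le
    _ = (∫⁻ u, ‖W (c β * ((z - τ z) - (u - τ u)), β)‖ₑ) + ∫⁻ u, ‖W (c β * (z - u), β)‖ₑ :=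
        lintegral_add_right _
          ((measurable_rotated hc measurable_id z hW).comp measurable_prodMk_left).enorm
    _ ≤ _ := by
        rw [add_mul, one_mul, hrotated]
        gcongr
        exact hdeformed β

lemma IsDeformationBound.mono {κ κ' : ℝ≥0∞} (h : IsDeformationBound τ ε W κ) (hκ : κ ≤ κ') :
    IsDeformationBound τ ε W κ' :=
  ⟨h.measurable, h.norm_le.trans hκ, fun c hc hc1 z => (h.deform_le c hc hc1 z).trans (by gcongr)⟩

lemma IsDeformationBound.of_tendsto (hτ : ContractiveField τ ε) {ι : Type*} {l : Filter ι} [l.NeBot]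
    {V : ι → ℂ × S1 → ℝ} {κ : ℝ≥0∞} (hW : Measurable W)
    (hbound : ∀ i, IsDeformationBound τ ε (V i) κ)
    (hlim : Tendsto (fun i => ∫⁻ p, ‖W p - V i p‖ₑ ∂jointMeasure) l (𝓝 0)) :
    IsDeformationBound τ ε W κ where
  measurable := hW
  norm_le := by
    have hsum : Tendsto (fun i => κ + ∫⁻ p, ‖W p - V i p‖ₑ ∂jointMeasure) l (𝓝 κ) := by
      simpa using hlim.const_add κ
    refine ge_of_tendsto' hsum fun i => ?_
    calc ∫⁻ p, ‖W p‖ₑ ∂jointMeasure ≤ ∫⁻ p, (‖V i p‖ₑ + ‖W p - V i p‖ₑ) ∂jointMeasure :=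
          lintegral_mono fun p => by simpa using enorm_add_le (V i p) (W p - V i p)
      _ ≤ _ := by
          rw [lintegral_add_left (hbound i).measurable.enorm]
          gcongr
          exact (hbound i).norm_le
  deform_le c hc hc1 z := by
    have hsum := (ENNReal.Tendsto.const_mul (a := ENNReal.ofReal ((1 - ε)⁻¹ ^ 2) + 1) hlim
      (Or.inr (by finiteness))).const_add (ENNReal.ofReal (ε * (1 - ε)⁻¹ ^ 3) * κ)
    rw [mul_zero, add_zero] at hsum
    exact ge_of_tendsto' hsum fun i =>
      (deformDefect_le_add hτ.differentiable.continuous.measurable hc z (hbound i).measurable).trans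
        (add_le_add ((hbound i).deform_le c hc hc1 z)
          (deformDefect_le hτ hc hc1 z (hW.sub (hbound i).measurable)))

end Approximation

section FiniteFilter

/-- The filter `∑_{(k,m)∈s} a(k,m) ψ_{j,k}(v) φ_m(β)`. -/
def fbFilter (j : ℝ) (s : Finset (FBIndex × ℤ)) (a : FBIndex × ℤ → ℝ) (p : ℂ × S1) : ℝ :=
  ∑ q ∈ s, a q * (fbScaled j q.1 p.1 * circleBasis q.2 p.2)

variable (j : ℝ) (s : Finset (FBIndex × ℤ)) (a : FBIndex × ℤ → ℝ)

lemma fbFilter_eq_indicator (v : ℂ) (β : S1) :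
    fbFilter j s a (v, β) = ((2 : ℝ) ^ (-j)) ^ 2 *
      unitDisk.indicator (fbSum s a β) (((2 : ℝ) ^ (-j) : ℝ) * v) := by
  have hscale : (2 : ℝ) ^ (-2 * j) = ((2 : ℝ) ^ (-j)) ^ 2 := by
    rw [← Real.rpow_natCast, ← Real.rpow_mul zero_le_two]
    congr 1
    push_cast
    ring
  simp only [fbFilter, fbScaled, fbBasis_eq_indicator, hscale]
  by_cases hv : (((2 : ℝ) ^ (-j) : ℝ) : ℂ) * v ∈ unitDisk
  · simp only [Set.indicator_of_mem hv, fbSum, Finset.mul_sum]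
    exact Finset.sum_congr rfl fun q _ => by ring
  · simp [Set.indicator_of_notMem hv]

lemma measurable_fbScaled (k : FBIndex) : Measurable (fbScaled j k) := by
  have hbasis : Measurable (fbBasis k) := by
    rw [fbBasis_eq_indicator]
    exact (contDiff_fbSmooth k).continuous.measurable.indicator measurableSet_unitDisk
  exact (hbasis.comp (measurable_const_mul _)).const_mul _

lemma measurable_fbFilter : Measurable (fbFilter j s a) :=
  Finset.measurable_fun_sum _ fun q _ => (((measurable_fbScaled j q.1).comp measurable_fst).mul
    ((continuous_circleBasis _).measurable.comp measurable_snd)).const_mul _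

lemma lintegral_enorm_fbFilter_le :
    ∫⁻ p, ‖fbFilter j s a p‖ₑ ∂jointMeasure ≤ ENNReal.ofReal (Real.pi * √(fbEnergy s a)) := by
  have hr : (0 : ℝ) < 2 ^ (-j) := by positivity
  rw [lintegral_prod_symm _ (measurable_fbFilter j s a).enorm.aemeasurable]
  refine (lintegral_congr fun β => ?_).trans_le (lintegral_enorm_fbSum_le s a)
  have hscale := lintegral_comp_mul_left_complex (Complex.ofReal_ne_zero.2 hr.ne')
    fun v => ‖unitDisk.indicator (fbSum s a β) v‖ₑ
  rw [Complex.norm_real, Real.norm_of_nonneg hr.le] at hscale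
  simp only [fbFilter_eq_indicator, enorm_mul, Real.enorm_of_nonneg (sq_nonneg ((2 : ℝ) ^ (-j)))]
  rw [lintegral_const_mul' _ _ ENNReal.ofReal_ne_top, hscale,
    ← lintegral_indicator measurableSet_unitDisk]
  simp only [enorm_indicator_eq_indicator_enorm]

lemma deformDefect_fbFilter_le {τ : ℂ → ℂ} {ε : ℝ} (h : ContractiveField τ ε) {c : S1 → ℂ}
    (hc1 : ∀ β, ‖c β‖ = 1) (z : ℂ) :
    deformDefect τ c z (fbFilter j s a)
      ≤ ENNReal.ofReal (ε * (1 - ε)⁻¹ ^ 3) * ENNReal.ofReal (Real.pi * √(fbEnergy s a)) := by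
  have hr : (0 : ℝ) < 2 ^ (-j) := by positivity
  have hnorm (β : S1) : ‖((2 : ℝ) ^ (-j) : ℝ) * c β‖ = 2 ^ (-j) := by
    rw [norm_mul, hc1, mul_one, Complex.norm_real, Real.norm_of_nonneg hr.le]
  refine le_trans (lintegral_mono fun β => ?_) ((lintegral_const_mul' _ _
    ENNReal.ofReal_ne_top).trans_le (mul_le_mul_right (lintegral_enorm_fderiv_fbSum_le s a) _))
  have hslice := h.lintegral_enorm_indicator_deform_sub_le (contDiff_fbSum s a β)
    (fun v hv => fbSum_eq_zero s a β hv) (norm_ne_zero_iff.1 ((hnorm β).trans_ne hr.ne')) z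
  rw [hnorm, ← lintegral_const_mul' _ _ ENNReal.ofReal_ne_top] at hslice
  refine hslice.trans_eq' (lintegral_congr fun u => ?_)
  simp only [fbFilter_eq_indicator, mul_assoc]
  rw [← mul_sub, enorm_mul, Real.enorm_of_nonneg (sq_nonneg _)]

lemma isDeformationBound_fbFilter {τ : ℂ → ℂ} {ε : ℝ} (h : ContractiveField τ ε) :
    IsDeformationBound τ ε (fbFilter j s a) (ENNReal.ofReal (Real.pi * √(fbEnergy s a))) :=
  ⟨measurable_fbFilter j s a, lintegral_enorm_fbFilter_le j s a,
    fun _ _ hc1 z => deformDefect_fbFilter_le j s a h hc1 z⟩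

end FiniteFilter

section Convergence

lemma eLpNorm_one_le_eLpNorm_two_mul {α : Type*} [MeasurableSpace α] {μ : Measure α} {f : α → ℝ}
    (hf : AEStronglyMeasurable f μ) {K : Set α} (hK : MeasurableSet K)
    (hsupp : f =ᵐ[μ.restrict Kᶜ] 0) : eLpNorm f 1 μ ≤ eLpNorm f 2 μ * μ K ^ (1 / 2 : ℝ) := by
  have hout : ∫⁻ x in Kᶜ, ‖f x‖ₑ ∂μ = 0 := by
    rw [← eLpNorm_one_eq_lintegral_enorm, eLpNorm_congr_ae hsupp, eLpNorm_zero]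
  calc eLpNorm f 1 μ = eLpNorm f 1 (μ.restrict K) := by
        rw [eLpNorm_one_eq_lintegral_enorm, ← lintegral_add_compl _ hK, hout, add_zero,
          eLpNorm_one_eq_lintegral_enorm]
    _ ≤ eLpNorm f 2 (μ.restrict K) * μ K ^ (1 / 2 : ℝ) := by
        have hHolder := eLpNorm_le_eLpNorm_mul_rpow_measure_univ (p := 1) (q := 2)
          (by norm_num) (hf.restrict (s := K))
        norm_num at hHolder ⊢
        exact hHolder
    _ ≤ _ := by
        gcongr
        exact Measure.restrict_le_self

lemma tendsto_eLpNorm_one_of_tendsto_eLpNorm_two {α ι : Type*} [MeasurableSpace α] {μ : Measure α}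
    {l : Filter ι} [l.NeBot] {W : α → ℝ} {V : ι → α → ℝ} (hW : AEStronglyMeasurable W μ)
    (hV : ∀ i, AEStronglyMeasurable (V i) μ) {K : Set α} (hK : MeasurableSet K) (hμK : μ K ≠ ∞)
    (hsupp : ∀ i, ∀ x ∉ K, V i x = 0)
    (hlim : Tendsto (fun i => eLpNorm (W - V i) 2 μ) l (𝓝 0)) :
    Tendsto (fun i => eLpNorm (W - V i) 1 μ) l (𝓝 0) := by
  have hV0 (i : ι) : V i =ᵐ[μ.restrict Kᶜ] 0 :=
    (ae_restrict_mem hK.compl).mono fun x hx => hsupp i x hx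
  have hW0 : W =ᵐ[μ.restrict Kᶜ] 0 := by
    refine (eLpNorm_eq_zero_iff hW.restrict two_ne_zero).1 <|
      le_antisymm (ge_of_tendsto' hlim fun i => ?_) zero_le
    calc eLpNorm W 2 (μ.restrict Kᶜ) = eLpNorm (W - V i) 2 (μ.restrict Kᶜ) :=
          eLpNorm_congr_ae ((hV0 i).mono fun x hx => by simp [hx])
      _ ≤ _ := eLpNorm_mono_measure _ Measure.restrict_le_self
  have hbound := ENNReal.Tendsto.mul_const (b := μ K ^ (1 / 2 : ℝ)) hlim
    (Or.inr (ENNReal.rpow_ne_top_of_nonneg (by norm_num) hμK))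
  rw [zero_mul] at hbound
  exact tendsto_of_tendsto_of_tendsto_of_le_of_le tendsto_const_nhds hbound (fun i => zero_le)
    fun i => eLpNorm_one_le_eLpNorm_two_mul (hW.sub (hV i)) hK
      (by simpa using hW0.sub (hV0 i))

lemma fbScaled_eq_zero {j : ℝ} {k : FBIndex} {v : ℂ} (hv : v ∉ Metric.closedBall (0 : ℂ) (2 ^ j)) :
    fbScaled j k v = 0 := by
  have hr : (0 : ℝ) < 2 ^ j := by positivity
  have hout : (((2 : ℝ) ^ (-j) : ℝ) : ℂ) * v ∉ unitDisk := by
    rw [mem_closedBall_zero_iff, not_le] at hv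
    rw [unitDisk, mem_closedBall_zero_iff, not_le, norm_mul, Complex.norm_real,
      Real.rpow_neg zero_le_two, norm_inv, Real.norm_of_nonneg hr.le, ← div_eq_inv_mul,
      one_lt_div hr]
    exact hv
  rw [fbScaled, fbBasis_eq_indicator, Set.indicator_of_notMem hout, mul_zero]

lemma fbFilter_eq_zero (j : ℝ) (s : Finset (FBIndex × ℤ)) (a : FBIndex × ℤ → ℝ) {p : ℂ × S1}
    (hp : p ∉ Metric.closedBall (0 : ℂ) (2 ^ j) ×ˢ Set.univ) : fbFilter j s a p = 0 :=
  Finset.sum_eq_zero fun q _ => by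
    rw [fbScaled_eq_zero fun hv => hp ⟨hv, trivial⟩, zero_mul, mul_zero]

lemma ofReal_pi_mul_sqrt_fbEnergy_le (s : Finset (FBIndex × ℤ)) (a : FBIndex → ℤ → ℝ) :
    ENNReal.ofReal (Real.pi * √(fbEnergy s a.uncurry))
      ≤ ENNReal.ofReal Real.pi * fbNormJoint a := by
  have hterm (q : FBIndex × ℤ) : 0 ≤ fbEigenvalue q.1 * a.uncurry q ^ 2 :=
    mul_nonneg (fbEigenvalue_nonneg _) (sq_nonneg _)
  rw [ENNReal.ofReal_mul Real.pi_pos.le, fbEnergy, Real.sqrt_eq_rpow, fbNormJoint,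
    ← ENNReal.ofReal_rpow_of_nonneg (Finset.sum_nonneg fun q _ => hterm q) (by norm_num),
    ENNReal.ofReal_sum_of_nonneg fun q _ => hterm q,
    ← ENNReal.tsum_prod (f := fun k m => ENNReal.ofReal (fbEigenvalue k * a k m ^ 2))]
  gcongr
  exact ENNReal.sum_le_tsum s

variable {τ : ℂ → ℂ} {ε : ℝ} {j : ℝ}

lemma isDeformationBound_of_tendsto_eLpNorm (hτ : ContractiveField τ ε) {ι : Type*} {l : Filter ι}
    [l.NeBot] {s : ι → Finset (FBIndex × ℤ)} {a : FBIndex → ℤ → ℝ} {W : ℂ × S1 → ℝ}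
    (hW : Measurable W)
    (hlim : Tendsto (fun i => eLpNorm (W - fbFilter j (s i) a.uncurry) 2 jointMeasure) l (𝓝 0)) :
    IsDeformationBound τ ε W (ENNReal.ofReal Real.pi * fbNormJoint a) := by
  refine .of_tendsto (l := l) hτ hW
    (fun i => (isDeformationBound_fbFilter j (s i) _ hτ).mono
      (ofReal_pi_mul_sqrt_fbEnergy_le (s i) a)) ?_
  simp_rw [← Pi.sub_apply, ← eLpNorm_one_eq_lintegral_enorm]
  refine tendsto_eLpNorm_one_of_tendsto_eLpNorm_two hW.aestronglyMeasurable
    (fun i => (measurable_fbFilter j (s i) _).aestronglyMeasurable)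
    (Metric.isClosed_closedBall.measurableSet.prod MeasurableSet.univ) ?_
    (fun i p => fbFilter_eq_zero j (s i) _) hlim
  rw [Measure.prod_prod]
  exact ENNReal.mul_ne_top (isCompact_closedBall _ _).measure_ne_top (by simp)

lemma IsJointExpansion.isDeformationBound (hτ : ContractiveField τ ε) {a : FBIndex → ℤ → ℝ}
    {W : ℂ → S1 → ℝ} (h : IsJointExpansion j a W) {W' : ℂ × S1 → ℝ} (hW' : Measurable W')
    (hWW' : (fun p => W p.1 p.2) =ᵐ[jointMeasure] W') :
    IsDeformationBound τ ε W' (ENNReal.ofReal Real.pi * fbNormJoint a) :=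
  isDeformationBound_of_tendsto_eLpNorm (j := j) hτ (s := id) hW' <| h.2.congr fun s =>
    eLpNorm_congr_ae <| hWW'.mono fun p hp => by simp [← hp, fbFilter, Function.uncurry]

lemma fbNormPlane_eq_fbNormJoint (a : FBIndex → ℝ) :
    fbNormPlane a = fbNormJoint fun k m => if m = 0 then a k else 0 := by
  unfold fbNormPlane fbNormJoint
  congr 2 with k
  rw [tsum_eq_single 0 fun m hm => by simp [hm]]
  simp

lemma IsPlaneExpansion.isDeformationBound (hτ : ContractiveField τ ε) {a : FBIndex → ℝ} {W : ℂ → ℝ}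
    (h : IsPlaneExpansion j a W) {W' : ℂ → ℝ} (hW' : Measurable W') (hWW' : W =ᵐ[volume] W') :
    IsDeformationBound τ ε (fun p => W' p.1) (ENNReal.ofReal Real.pi * fbNormPlane a) := by
  rw [fbNormPlane_eq_fbNormJoint]
  refine isDeformationBound_of_tendsto_eLpNorm (j := j) hτ (l := atTop)
    (s := fun s : Finset FBIndex => s ×ˢ {0}) (hW'.comp measurable_fst) <| h.2.congr fun s => ?_
  have hsum : Measurable fun v => W' v - ∑ k ∈ s, a k * fbScaled j k v :=
    hW'.sub (Finset.measurable_fun_sum _ fun k _ => (measurable_fbScaled j k).const_mul _)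
  calc _ = eLpNorm (fun v => W' v - ∑ k ∈ s, a k * fbScaled j k v) 2 volume :=
        eLpNorm_congr_ae <| hWW'.mono fun v hv => by simp [hv]
    _ = _ := by
        rw [← eLpNorm_comp_measurePreserving hsum.aestronglyMeasurable
          (measurePreserving_fst (μ := volume) (ν := circleMeasure))]
        congr 1 with p
        simp [fbFilter, Function.uncurry, circleBasis]

end Convergence

/-! ### Schur's test -/

section Schur

variable {α β : Type*} [MeasurableSpace α] [MeasurableSpace β] {μ : Measure α} {ν : Measure β}

lemma eLpNorm_two_sq (f : α → ℝ) : eLpNorm f 2 μ ^ 2 = ∫⁻ x, ‖f x‖ₑ ^ 2 ∂μ := by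
  simpa using eLpNorm_nnreal_pow_eq_lintegral (μ := μ) (f := f) (p := 2) two_ne_zero

lemma sq_lintegral_mul_le {K f : α → ℝ≥0∞} (hK : Measurable K) (hf : Measurable f) :
    (∫⁻ x, K x * f x ∂μ) ^ 2 ≤ (∫⁻ x, K x ∂μ) * ∫⁻ x, K x * f x ^ 2 ∂μ := by
  have hHolder := ENNReal.lintegral_mul_le_Lp_mul_Lq (μ.withDensity K)
    Real.HolderConjugate.two_two (f := 1) measurable_one.aemeasurable hf.aemeasurable
  rw [lintegral_withDensity_eq_lintegral_mul _ hK (measurable_one.mul hf),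
    lintegral_withDensity_eq_lintegral_mul _ hK (measurable_one.pow_const _),
    lintegral_withDensity_eq_lintegral_mul _ hK (hf.pow_const _)] at hHolder
  simp only [Pi.mul_apply, Pi.one_apply, one_mul, ENNReal.rpow_two] at hHolder
  refine (pow_le_pow_left' hHolder 2).trans_eq ?_
  rw [mul_pow]
  simp only [← ENNReal.rpow_natCast, ← ENNReal.rpow_mul]
  norm_num

lemma sq_sum_mul_le {ι : Type*} [Fintype ι] (K f : ι → ℝ≥0∞) :
    (∑ i, K i * f i) ^ 2 ≤ (∑ i, K i) * ∑ i, K i * f i ^ 2 := by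
  let _ : MeasurableSpace ι := ⊤
  have h := sq_lintegral_mul_le (μ := (Measure.count : Measure ι)) (K := K) (f := f)
    measurable_from_top measurable_from_top
  simpa only [lintegral_count, tsum_fintype] using h

/-- A kernel satisfying the hypotheses of Schur's test: the `L¹` norms of its rows and of its
columns are at most `C`. -/
structure IsSchurKernel (K : α → β → ℝ) (C : ℝ≥0∞) (μ : Measure α) (ν : Measure β) : Prop where
  measurable : Measurable K.uncurry
  row_le : ∀ x, ∫⁻ y, ‖K x y‖ₑ ∂ν ≤ C
  col_le : ∀ y, ∫⁻ x, ‖K x y‖ₑ ∂μ ≤ C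

namespace IsSchurKernel

variable {K K₁ K₂ : α → β → ℝ} {C C₁ C₂ : ℝ≥0∞}

lemma measurable_row (h : IsSchurKernel K C μ ν) (x : α) : Measurable (K x) :=
  h.measurable.comp measurable_prodMk_left

lemma measurable_col (h : IsSchurKernel K C μ ν) (y : β) : Measurable fun x => K x y :=
  h.measurable.comp measurable_prodMk_right

lemma of_enorm_le (h₁ : IsSchurKernel K₁ C₁ μ ν) (h₂ : IsSchurKernel K₂ C₂ μ ν)
    (hK : Measurable K.uncurry) (a b : ℝ≥0∞)
    (hle : ∀ x y, ‖K x y‖ₑ ≤ a * ‖K₁ x y‖ₑ + b * ‖K₂ x y‖ₑ) :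
    IsSchurKernel K (a * C₁ + b * C₂) μ ν where
  measurable := hK
  row_le x := by
    refine (lintegral_mono (hle x)).trans ?_
    rw [lintegral_add_left ((h₁.measurable_row x).enorm.const_mul a),
      lintegral_const_mul a (h₁.measurable_row x).enorm,
      lintegral_const_mul b (h₂.measurable_row x).enorm]
    gcongr
    exacts [h₁.row_le x, h₂.row_le x]
  col_le y := by
    refine (lintegral_mono fun x => hle x y).trans ?_
    rw [lintegral_add_left ((h₁.measurable_col y).enorm.const_mul a),
      lintegral_const_mul a (h₁.measurable_col y).enorm,
      lintegral_const_mul b (h₂.measurable_col y).enorm]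
    gcongr
    exacts [h₁.col_le y, h₂.col_le y]

variable [SFinite μ] [SFinite ν] {f : β → ℝ}

lemma lintegral_sq_le (h : IsSchurKernel K C μ ν) (hf : Measurable f) :
    ∫⁻ x, (∫⁻ y, ‖K x y‖ₑ * ‖f y‖ₑ ∂ν) ^ 2 ∂μ ≤ (C * eLpNorm f 2 ν) ^ 2 := by
  have hKf : Measurable fun p : α × β => ‖K p.1 p.2‖ₑ * ‖f p.2‖ₑ ^ 2 :=
    h.measurable.enorm.mul ((hf.comp measurable_snd).enorm.pow_const 2)
  calc _ ≤ ∫⁻ x, C * ∫⁻ y, ‖K x y‖ₑ * ‖f y‖ₑ ^ 2 ∂ν ∂μ := lintegral_mono fun x =>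
        (sq_lintegral_mul_le (h.measurable_row x).enorm hf.enorm).trans
          (by gcongr; exact h.row_le x)
    _ = C * ∫⁻ y, ∫⁻ x, ‖K x y‖ₑ * ‖f y‖ₑ ^ 2 ∂μ ∂ν := by
        rw [lintegral_const_mul _ hKf.lintegral_prod_right',
          lintegral_lintegral_swap hKf.aemeasurable]
    _ ≤ C * ∫⁻ y, C * ‖f y‖ₑ ^ 2 ∂ν := by
        gcongr with y
        rw [lintegral_mul_const _ (h.measurable_col y).enorm]
        gcongr
        exact h.col_le y
    _ = _ := by
        rw [lintegral_const_mul _ (hf.enorm.pow_const 2), ← eLpNorm_two_sq]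
        ring

lemma eLpNorm_integral_le (h : IsSchurKernel K C μ ν) (hf : Measurable f) :
    eLpNorm (fun x => ∫ y, f y * K x y ∂ν) 2 μ ≤ C * eLpNorm f 2 ν := by
  rw [← ENNReal.pow_le_pow_left_iff two_ne_zero, eLpNorm_two_sq]
  refine (lintegral_mono fun x => pow_le_pow_left' ?_ 2).trans (h.lintegral_sq_le hf)
  refine (enorm_integral_le_lintegral_enorm _).trans_eq (lintegral_congr fun y => ?_)
  rw [enorm_mul, mul_comm]

lemma ae_integrable_mul (h : IsSchurKernel K C μ ν) (hC : C ≠ ∞) (hf : Measurable f)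
    (hf₂ : MemLp f 2 ν) : ∀ᵐ x ∂μ, Integrable (fun y => f y * K x y) ν := by
  have hmeas : Measurable fun x => (∫⁻ y, ‖K x y‖ₑ * ‖f y‖ₑ ∂ν) ^ 2 :=
    (Measurable.lintegral_prod_right' (f := fun p : α × β => ‖K p.1 p.2‖ₑ * ‖f p.2‖ₑ)
      (h.measurable.enorm.mul (hf.comp measurable_snd).enorm)).pow_const 2
  have hfin : (C * eLpNorm f 2 ν) ^ 2 ≠ ∞ := (ENNReal.pow_lt_top
    (ENNReal.mul_lt_top hC.lt_top hf₂.eLpNorm_lt_top)).ne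
  filter_upwards [ae_lt_top hmeas (ne_top_of_le_ne_top hfin (h.lintegral_sq_le hf))] with x hx
  refine ⟨(hf.mul (h.measurable_row x)).aestronglyMeasurable, ?_⟩
  refine ((ENNReal.pow_lt_top_iff.1 hx).resolve_right two_ne_zero).trans_eq' ?_
  exact lintegral_congr fun y => by rw [enorm_mul, mul_comm]

end IsSchurKernel

end Schur

/-! ### Relative positions in the plane times the circle -/

section Frame

lemma norm_toCircle (t : S1) : ‖(AddCircle.toCircle t : ℂ)‖ = 1 := Circle.norm_coe _

@[fun_prop]
lemma continuous_toCircle : Continuous fun t : S1 => (AddCircle.toCircle t : ℂ) :=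
  continuous_subtype_val.comp AddCircle.continuous_toCircle

/-- The coordinates of `q` relative to the position and orientation given by `P`. A filter `W` of a
joint layer is evaluated at `frame (u, α) (u + v', α')`. -/
def frame (P q : ℂ × S1) : ℂ × S1 := (AddCircle.toCircle P.2 * (q.1 - P.1), q.2 - P.2)

@[fun_prop]
lemma measurable_frame : Measurable fun p : (ℂ × S1) × (ℂ × S1) => frame p.1 p.2 := by
  unfold frame
  exact Continuous.measurable (by fun_prop)

lemma measurable_frame_right (P : ℂ × S1) : Measurable (frame P) :=
  measurable_frame.comp measurable_prodMk_left

lemma measurable_frame_left (q : ℂ × S1) : Measurable fun P => frame P q :=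
  measurable_frame.comp measurable_prodMk_right

lemma lintegral_toCircle_mul (t : S1) (G : ℂ → ℝ≥0∞) :
    ∫⁻ u, G (AddCircle.toCircle t * u) = ∫⁻ u, G u := by
  simpa [norm_toCircle] using lintegral_comp_mul_left_complex (Circle.coe_ne_zero t.toCircle) G

lemma lintegral_frame_right (P : ℂ × S1) {G : ℂ × S1 → ℝ≥0∞} (hG : Measurable G) :
    ∫⁻ q, G (frame P q) ∂jointMeasure = ∫⁻ q, G q ∂jointMeasure := by
  have hGframe : Measurable fun q => G (frame P q) := hG.comp (measurable_frame_right P)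
  rw [lintegral_prod_symm _ hGframe.aemeasurable,
    lintegral_prod_symm _ hG.aemeasurable]
  simp only [frame]
  rw [lintegral_sub_right_eq_self
    (fun β => ∫⁻ u, G (AddCircle.toCircle P.2 * (u - P.1), β)) P.2]
  refine lintegral_congr fun β => ?_
  rw [lintegral_sub_right_eq_self (fun u => G (AddCircle.toCircle P.2 * u, β)) P.1,
    lintegral_toCircle_mul P.2 fun u => G (u, β)]

lemma lintegral_frame_left (q : ℂ × S1) {G : ℂ × S1 → ℝ≥0∞} (hG : Measurable G) :
    ∫⁻ P, G (frame P q) ∂jointMeasure = ∫⁻ p, G p ∂jointMeasure := by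
  have hGframe : Measurable fun P => G (frame P q) := hG.comp (measurable_frame_left q)
  rw [lintegral_prod_symm _ hGframe.aemeasurable,
    lintegral_prod_symm _ hG.aemeasurable]
  simp only [frame]
  rw [← lintegral_sub_left_eq_self (fun β => ∫⁻ u, G (u, β) ∂volume) q.2]
  refine lintegral_congr fun α => ?_
  rw [lintegral_sub_left_eq_self (fun u => G (AddCircle.toCircle α * u, q.2 - α)) q.1,
    lintegral_toCircle_mul α fun u => G (u, q.2 - α)]

lemma measurePreserving_frame (P : ℂ × S1) :
    MeasurePreserving (frame P) jointMeasure jointMeasure := by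
  refine ⟨measurable_frame_right P, Measure.ext fun s hs => ?_⟩
  rw [← lintegral_indicator_one hs, ← lintegral_indicator_one hs,
    lintegral_map (measurable_one.indicator hs) (measurable_frame_right P),
    lintegral_frame_right P (measurable_one.indicator hs)]

end Frame

/-! ### Deformation of functions on the plane times the circle -/

section Deform

/-- The deformation `(u, α) ↦ (u - τ u, α)`. -/
def deform (τ : ℂ → ℂ) (p : ℂ × S1) : ℂ × S1 := (p.1 - τ p.1, p.2)

variable {τ : ℂ → ℂ} {ε : ℝ}

@[fun_prop]
lemma measurable_jacobian (τ : ℂ → ℂ) : Measurable (jacobian τ) :=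
  (ContinuousLinearMap.continuous_det.measurable.comp
    (measurable_const.sub (measurable_fderiv ℝ τ))).norm

namespace ContractiveField

lemma measurable_deform (h : ContractiveField τ ε) : Measurable (deform τ) :=
  ((measurable_id.sub h.differentiable.continuous.measurable).comp measurable_fst).prodMk
    measurable_snd

lemma measurePreserving_deform (h : ContractiveField τ ε) :
    MeasurePreserving (deform τ)
      (jointMeasure.withDensity fun p => ENNReal.ofReal (jacobian τ p.1)) jointMeasure := by
  refine ⟨h.measurable_deform, Measure.ext fun s hs => ?_⟩
  have hJ : Measurable fun p : ℂ × S1 => ENNReal.ofReal (jacobian τ p.1) := by fun_prop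
  have hind : Measurable (s.indicator (1 : ℂ × S1 → ℝ≥0∞)) := measurable_one.indicator hs
  have hindτ : Measurable fun p => s.indicator (1 : ℂ × S1 → ℝ≥0∞) (deform τ p) :=
    hind.comp h.measurable_deform
  rw [← lintegral_indicator_one hs, ← lintegral_indicator_one hs,
    lintegral_map hind h.measurable_deform, lintegral_withDensity_eq_lintegral_mul _ hJ hindτ,
    lintegral_prod_symm _ (hJ.mul hindτ).aemeasurable, lintegral_prod_symm _ hind.aemeasurable]
  exact lintegral_congr fun β => h.lintegral_jacobian_mul fun u => s.indicator 1 (u, β)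

lemma lintegral_comp_deform_le (h : ContractiveField τ ε) {G : ℂ × S1 → ℝ≥0∞} (hG : Measurable G) :
    ∫⁻ p, G (deform τ p) ∂jointMeasure
      ≤ ENNReal.ofReal ((1 - ε)⁻¹ ^ 2) * ∫⁻ p, G p ∂jointMeasure := by
  have hGdeform : Measurable fun p => G (deform τ p) := hG.comp h.measurable_deform
  rw [lintegral_prod_symm _ hGdeform.aemeasurable,
    lintegral_prod_symm _ hG.aemeasurable, ← lintegral_const_mul' _ _ ENNReal.ofReal_ne_top]
  exact lintegral_mono fun β => h.lintegral_comp_le fun u => G (u, β)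

lemma quasiMeasurePreserving_deform (h : ContractiveField τ ε) :
    Measure.QuasiMeasurePreserving (deform τ) jointMeasure jointMeasure := by
  refine ⟨h.measurable_deform, Measure.AbsolutelyContinuous.mk fun s hs hs0 => ?_⟩
  have hind : Measurable (s.indicator (1 : ℂ × S1 → ℝ≥0∞)) := measurable_one.indicator hs
  rw [← lintegral_indicator_one hs, lintegral_map hind h.measurable_deform]
  refine le_antisymm ((h.lintegral_comp_deform_le hind).trans ?_) zero_le
  rw [lintegral_indicator_one hs, hs0, mul_zero]

lemma eLpNorm_comp_deform_le (h : ContractiveField τ ε) {f : ℂ × S1 → ℝ} (hf : Measurable f) :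
    eLpNorm (f ∘ deform τ) 2 jointMeasure
      ≤ ENNReal.ofReal (1 - ε)⁻¹ * eLpNorm f 2 jointMeasure := by
  rw [← ENNReal.pow_le_pow_left_iff two_ne_zero, mul_pow, eLpNorm_two_sq, eLpNorm_two_sq,
    ← ENNReal.ofReal_pow (inv_nonneg.2 h.one_sub_pos.le)]
  exact h.lintegral_comp_deform_le (hf.enorm.pow_const 2)

lemma integrable_jacobian_mul_iff (h : ContractiveField τ ε) {f : ℂ × S1 → ℝ} (hf : Measurable f) :
    Integrable (fun q => jacobian τ q.1 * f (deform τ q)) jointMeasure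
      ↔ Integrable f jointMeasure := by
  rw [← h.measurePreserving_deform.integrable_comp hf.aestronglyMeasurable,
    integrable_withDensity_iff_integrable_smul' (by fun_prop) (by simp)]
  simp [jacobian]

lemma integral_jacobian_mul (h : ContractiveField τ ε) {f : ℂ × S1 → ℝ} (hf : Measurable f) :
    ∫ q, jacobian τ q.1 * f (deform τ q) ∂jointMeasure = ∫ q, f q ∂jointMeasure := by
  conv_rhs => rw [← h.measurePreserving_deform.map_eq]
  rw [integral_map h.measurable_deform.aemeasurable hf.aestronglyMeasurable,
    integral_withDensity_eq_integral_toReal_smul (by fun_prop) (by simp)]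
  simp [jacobian]

end ContractiveField

end Deform

/-! ### Joint convolutions -/

section JointConvolution

/-- The pre-activation of one channel of a joint layer with filter `W` and input `x`. -/
def jointConv (W x : ℂ × S1 → ℝ) (P : ℂ × S1) : ℝ := ∫ q, x q * W (frame P q) ∂jointMeasure

/-- The measurable function `x` differs from the constant `c` by a function in `L²`. Layer outputs
are of this form rather than in `L²`, because of the biases and since `σ 0` may be nonzero. -/
structure CenteredAt (x : ℂ × S1 → ℝ) (c : ℝ) : Prop where
  measurable : Measurable x
  memLp : MemLp (fun q => x q - c) 2 jointMeasure

variable {τ : ℂ → ℂ} {ε : ℝ} {W x y : ℂ × S1 → ℝ} {κ : ℝ≥0∞} {c d : ℝ}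

lemma measurable_jointConv (hW : Measurable W) (hx : Measurable x) :
    Measurable (jointConv W x) := by
  have hxW : Measurable fun p : (ℂ × S1) × (ℂ × S1) => x p.2 * W (frame p.1 p.2) := by fun_prop
  exact hxW.stronglyMeasurable.integral_prod_right'.measurable

lemma jointConv_const (hW : Measurable W) (c : ℝ) (P : ℂ × S1) :
    jointConv W (fun _ => c) P = c * ∫ q, W q ∂jointMeasure := by
  rw [jointConv, integral_const_mul]
  conv_rhs => rw [← (measurePreserving_frame P).map_eq]
  rw [integral_map (measurable_frame_right P).aemeasurable hW.aestronglyMeasurable]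

lemma centeredAt_const (c : ℝ) : CenteredAt (fun _ => c) c :=
  ⟨measurable_const, by simp⟩

lemma CenteredAt.comp_deform (hx : CenteredAt x c) (hτ : ContractiveField τ ε) :
    CenteredAt (x ∘ deform τ) c where
  measurable := hx.measurable.comp hτ.measurable_deform
  memLp := ⟨(hx.measurable.comp hτ.measurable_deform).sub_const c |>.aestronglyMeasurable,
    (hτ.eLpNorm_comp_deform_le (hx.measurable.sub_const c)).trans_lt
      (ENNReal.mul_lt_top ENNReal.ofReal_lt_top hx.memLp.eLpNorm_lt_top)⟩

namespace IsDeformationBound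

lemma isSchurKernel (h : IsDeformationBound τ ε W κ) :
    IsSchurKernel (fun P q => W (frame P q)) κ jointMeasure jointMeasure where
  measurable := h.measurable.comp measurable_frame
  row_le P := (lintegral_frame_right P h.measurable.enorm).trans_le h.norm_le
  col_le q := (lintegral_frame_left q h.measurable.enorm).trans_le h.norm_le

lemma integrable_frame (h : IsDeformationBound τ ε W κ) (hκ : κ ≠ ∞) (P : ℂ × S1) :
    Integrable (fun q => W (frame P q)) jointMeasure :=
  ⟨(h.isSchurKernel.measurable_row P).aestronglyMeasurable,
    (h.isSchurKernel.row_le P).trans_lt hκ.lt_top⟩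

lemma ae_integrable (h : IsDeformationBound τ ε W κ) (hκ : κ ≠ ∞) (hx : CenteredAt x c) :
    ∀ᵐ P ∂jointMeasure, Integrable (fun q => x q * W (frame P q)) jointMeasure := by
  filter_upwards [h.isSchurKernel.ae_integrable_mul hκ (hx.measurable.sub_const c) hx.memLp]
    with P hP
  refine (hP.add ((h.integrable_frame hκ P).const_mul c)).congr (.of_forall fun q => ?_)
  simp only [Pi.add_apply]
  ring

lemma ae_jointConv_eq (h : IsDeformationBound τ ε W κ) (hκ : κ ≠ ∞) (hx : CenteredAt x c) :
    ∀ᵐ P ∂jointMeasure, jointConv W x P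
      = jointConv W (fun q => x q - c) P + c * ∫ q, W q ∂jointMeasure := by
  filter_upwards [h.ae_integrable hκ hx] with P hP
  rw [← jointConv_const h.measurable c P, ← sub_eq_iff_eq_add, jointConv, jointConv, jointConv,
    ← integral_sub hP ((h.integrable_frame hκ P).const_mul c)]
  simp only [sub_mul]

lemma eLpNorm_jointConv_sub_le (h : IsDeformationBound τ ε W κ) (hκ : κ ≠ ∞)
    (hx : CenteredAt x c) (hy : CenteredAt y d) :
    eLpNorm (fun P => jointConv W x P - jointConv W y P) 2 jointMeasure
      ≤ κ * eLpNorm (fun q => x q - y q) 2 jointMeasure := by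
  refine (eLpNorm_congr_ae ?_).trans_le
    (h.isSchurKernel.eLpNorm_integral_le (hx.measurable.sub hy.measurable))
  filter_upwards [h.ae_integrable hκ hx, h.ae_integrable hκ hy] with P hPx hPy
  rw [jointConv, jointConv, ← integral_sub hPx hPy]
  simp only [sub_mul]

end IsDeformationBound

end JointConvolution

/-! ### Commuting a joint convolution with the deformation -/

section Commutator

variable {τ : ℂ → ℂ} {ε : ℝ} {W x y : ℂ × S1 → ℝ} {κ : ℝ≥0∞} {c : ℝ}

/-- The kernel of the commutator of a joint convolution with the deformation, as an integral
operator applied to the deformed input. -/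
def commutatorKernel (τ : ℂ → ℂ) (W : ℂ × S1 → ℝ) (P q : ℂ × S1) : ℝ :=
  W (frame P q) - jacobian τ q.1 * W (frame (deform τ P) (deform τ q))

/-- The bound on the commutator of a layer with a deformation whose gradient is at most `ε`. -/
def commutatorConst (ε : ℝ) : ℝ := ((1 + ε) ^ 2 * (1 - ε)⁻¹ ^ 3 + 2 + ε) * ε * (1 - ε)⁻¹

lemma measurable_deformed_kernel (hτ : ContractiveField τ ε) (hW : Measurable W) :
    Measurable fun p : (ℂ × S1) × (ℂ × S1) => W (frame (deform τ p.1) (deform τ p.2)) :=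
  hW.comp (measurable_frame.comp ((hτ.measurable_deform.comp measurable_fst).prodMk
    (hτ.measurable_deform.comp measurable_snd)))

lemma jointConv_deform_sub_eq (hτ : ContractiveField τ ε) (hW : Measurable W)
    (hy : Measurable y) {P : ℂ × S1}
    (hP : Integrable (fun q => y (deform τ q) * W (frame P q)) jointMeasure)
    (hτP : Integrable (fun q => y q * W (frame (deform τ P) q)) jointMeasure) :
    jointConv W (y ∘ deform τ) P - jointConv W y (deform τ P)
      = ∫ q, y (deform τ q) * commutatorKernel τ W P q ∂jointMeasure := by
  have hmeas : Measurable fun q => y q * W (frame (deform τ P) q) :=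
    hy.mul (hW.comp (measurable_frame_right _))
  rw [jointConv, jointConv, ← hτ.integral_jacobian_mul hmeas]
  refine (integral_sub hP ((hτ.integrable_jacobian_mul_iff hmeas).2 hτP)).symm.trans ?_
  refine integral_congr_ae (.of_forall fun q => ?_)
  simp only [commutatorKernel]
  ring

namespace IsDeformationBound

lemma isSchurKernel_deform_sub (h : IsDeformationBound τ ε W κ) (hτ : ContractiveField τ ε) :
    IsSchurKernel (fun P q => W (frame (deform τ P) (deform τ q)) - W (frame P q))
      (ENNReal.ofReal (ε * (1 - ε)⁻¹ ^ 3) * κ) jointMeasure jointMeasure := by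
  have hmeas : Measurable fun p : (ℂ × S1) × (ℂ × S1) =>
      W (frame (deform τ p.1) (deform τ p.2)) - W (frame p.1 p.2) :=
    (measurable_deformed_kernel hτ h.measurable).sub h.isSchurKernel.measurable
  refine ⟨hmeas, fun P => ?_, fun q => ?_⟩
  · have hrow : Measurable fun q =>
        ‖W (frame (deform τ P) (deform τ q)) - W (frame P q)‖ₑ :=
      (hmeas.comp measurable_prodMk_left).enorm
    rw [lintegral_prod_symm _ hrow.aemeasurable]
    simp only [frame, deform]
    rw [lintegral_sub_right_eq_self (fun β => ∫⁻ u, ‖W (AddCircle.toCircle P.2 *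
      ((u - τ u) - (P.1 - τ P.1)), β) - W (AddCircle.toCircle P.2 * (u - P.1), β)‖ₑ) P.2]
    refine (h.deform_le (fun _ => -AddCircle.toCircle P.2) measurable_const
      (fun _ => by rw [norm_neg, norm_toCircle]) P.1).trans_eq' ?_
    simp only [deformDefect, neg_mul, ← mul_neg, neg_sub]
  · have hcol : Measurable fun P =>
        ‖W (frame (deform τ P) (deform τ q)) - W (frame P q)‖ₑ :=
      (hmeas.comp measurable_prodMk_right).enorm
    rw [lintegral_prod_symm _ hcol.aemeasurable, ← lintegral_sub_left_eq_self _ q.2]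
    simp only [frame, deform, sub_sub_cancel]
    exact h.deform_le (fun β => AddCircle.toCircle (q.2 - β))
      (Continuous.measurable (by fun_prop)) (fun β => norm_toCircle _) q.1

lemma isSchurKernel_commutatorKernel (h : IsDeformationBound τ ε W κ)
    (hτ : ContractiveField τ ε) :
    IsSchurKernel (commutatorKernel τ W)
      (ENNReal.ofReal (((1 + ε) ^ 2 * (1 - ε)⁻¹ ^ 3 + 2 + ε) * ε) * κ)
      jointMeasure jointMeasure := by
  have hε := hτ.nonneg
  have hε' := hτ.one_sub_pos
  have hmeas : Measurable (commutatorKernel τ W).uncurry :=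
    h.isSchurKernel.measurable.sub (((measurable_jacobian τ).comp (by fun_prop)).mul
      (measurable_deformed_kernel hτ h.measurable))
  convert (h.isSchurKernel_deform_sub hτ).of_enorm_le h.isSchurKernel hmeas
    (.ofReal ((1 + ε) ^ 2)) (.ofReal (2 * ε + ε ^ 2)) fun P q => ?_ using 1
  · rw [← mul_assoc, ← ENNReal.ofReal_mul (by positivity), ← add_mul,
      ← ENNReal.ofReal_add (by positivity) (by positivity)]
    ring_nf
  have hsplit : commutatorKernel τ W P q =
      -(jacobian τ q.1 * (W (frame (deform τ P) (deform τ q)) - W (frame P q)))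
        - (jacobian τ q.1 - 1) * W (frame P q) := by
    unfold commutatorKernel
    ring
  rw [hsplit]
  refine enorm_sub_le.trans (add_le_add ?_ ?_)
  · rw [enorm_neg, enorm_mul]
    gcongr
    rw [Real.enorm_eq_ofReal_abs, jacobian, abs_abs]
    exact ENNReal.ofReal_le_ofReal (hτ.jacobian_le q.1)
  · rw [enorm_mul]
    gcongr
    rw [Real.enorm_eq_ofReal_abs]
    exact ENNReal.ofReal_le_ofReal (hτ.abs_jacobian_sub_one_le q.1)

lemma eLpNorm_commutator_le (h : IsDeformationBound τ ε W κ) (hτ : ContractiveField τ ε)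
    (hκ : κ ≠ ∞) (hx : CenteredAt x c) :
    eLpNorm (fun P => jointConv W (x ∘ deform τ) P - jointConv W x (deform τ P)) 2 jointMeasure
      ≤ ENNReal.ofReal (commutatorConst ε) * κ * eLpNorm (fun q => x q - c) 2 jointMeasure := by
  have hε := hτ.nonneg
  have hε' := hτ.one_sub_pos
  have hxc : Measurable fun q => x q - c := hx.measurable.sub_const c
  have hxτ := hx.comp_deform hτ
  have heq : (fun P => jointConv W (x ∘ deform τ) P - jointConv W x (deform τ P))
      =ᵐ[jointMeasure] fun P =>
        ∫ q, (x (deform τ q) - c) * commutatorKernel τ W P q ∂jointMeasure := by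
    filter_upwards [h.ae_jointConv_eq hκ hxτ,
      hτ.quasiMeasurePreserving_deform.ae (h.ae_jointConv_eq hκ hx),
      h.isSchurKernel.ae_integrable_mul hκ (hxτ.measurable.sub_const c) hxτ.memLp,
      hτ.quasiMeasurePreserving_deform.ae (h.isSchurKernel.ae_integrable_mul hκ hxc hx.memLp)]
      with P hP hτP hint hτint
    rw [hP, hτP, add_sub_add_right_eq_sub]
    exact jointConv_deform_sub_eq hτ h.measurable hxc hint hτint
  calc _ ≤ ENNReal.ofReal (((1 + ε) ^ 2 * (1 - ε)⁻¹ ^ 3 + 2 + ε) * ε) * κ *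
        eLpNorm ((fun q => x q - c) ∘ deform τ) 2 jointMeasure :=
      (eLpNorm_congr_ae heq).trans_le <| (h.isSchurKernel_commutatorKernel hτ).eLpNorm_integral_le
        (hxτ.measurable.sub_const c)
    _ ≤ ENNReal.ofReal (((1 + ε) ^ 2 * (1 - ε)⁻¹ ^ 3 + 2 + ε) * ε) * κ *
        (ENNReal.ofReal (1 - ε)⁻¹ * eLpNorm (fun q => x q - c) 2 jointMeasure) := by
      gcongr
      exact hτ.eLpNorm_comp_deform_le hxc
    _ = _ := by
      rw [commutatorConst, ENNReal.ofReal_mul (q := (1 - ε)⁻¹) (by positivity)]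
      ring

end IsDeformationBound

end Commutator

/-! ### Features -/

section Features

variable {M : ℕ} {x y : Feature M} {c : Fin M → ℝ} (Ω : Set ℂ) {τ : ℂ → ℂ} {ε : ℝ}

/-- The channel `i` of a feature, as a function on the plane times the circle. -/
def channel (x : Feature M) (i : Fin M) (p : ℂ × S1) : ℝ := x p.1 p.2 i

lemma featureNorm_eq (x : Feature M) :
    featureNorm Ω x = ((M : ℝ≥0∞)⁻¹ * (volume Ω)⁻¹) ^ (1 / 2 : ℝ) *
      (∑ i, eLpNorm (channel x i) 2 jointMeasure ^ 2) ^ (1 / 2 : ℝ) := by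
  rw [← ENNReal.mul_rpow_of_nonneg _ _ (by norm_num), featureNorm, ← Finset.mul_sum, ← mul_assoc]
  simp only [eLpNorm_two_sq, channel]

lemma featureNorm_sq (x : Feature M) :
    featureNorm Ω x ^ 2
      = (volume Ω)⁻¹ * ((M : ℝ≥0∞)⁻¹ * ∑ i, eLpNorm (channel x i) 2 jointMeasure ^ 2) := by
  rw [featureNorm_eq, mul_pow, ← ENNReal.rpow_mul_natCast, ← ENNReal.rpow_mul_natCast]
  norm_num
  ring

lemma featureNorm_zero : featureNorm Ω (0 : Feature M) = 0 := by
  simp [featureNorm]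

lemma featureNorm_add_le (hx : ∀ i, Measurable (channel x i)) (hy : ∀ i, Measurable (channel y i)) :
    featureNorm Ω (x + y) ≤ featureNorm Ω x + featureNorm Ω y := by
  rw [featureNorm_eq, featureNorm_eq, featureNorm_eq, ← mul_add]
  gcongr
  have hMinkowski := ENNReal.Lp_add_le Finset.univ (fun i => eLpNorm (channel x i) 2 jointMeasure)
    (fun i => eLpNorm (channel y i) 2 jointMeasure) one_le_two
  simp only [ENNReal.rpow_two] at hMinkowski
  refine le_trans ?_ hMinkowski
  gcongr with i
  exact eLpNorm_add_le (hx i).aestronglyMeasurable (hy i).aestronglyMeasurable one_le_two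

/-- The channels of `x` are equal to the constants `c` up to functions in `L²`. -/
def Centered (x : Feature M) (c : Fin M → ℝ) : Prop := ∀ i, CenteredAt (channel x i) (c i)

/-- The feature with constant channels `c`. -/
def constFeature (c : Fin M → ℝ) : Feature M := fun _ _ i => c i

lemma centered_constFeature (c : Fin M → ℝ) : Centered (constFeature c) c :=
  fun i => centeredAt_const (c i)

lemma Centered.deformFeature (hx : Centered x c) (hτ : ContractiveField τ ε) :
    Centered (deformFeature τ x) c := fun i => (hx i).comp_deform hτ

lemma sum_sq_le_of_schur {M' : ℕ} {κ : Fin M' → Fin M → ℝ≥0∞} (hrow : ∀ i, ∑ i', κ i' i ≤ 1)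
    (hcol : ∀ i', (M' : ℝ≥0∞) / M * ∑ i, κ i' i ≤ 1) {f : Fin M' → ℝ≥0∞} {g : Fin M → ℝ≥0∞}
    (hg : ∀ i, g i ≤ ∑ i', κ i' i * f i') :
    (M : ℝ≥0∞)⁻¹ * ∑ i, g i ^ 2 ≤ (M' : ℝ≥0∞)⁻¹ * ∑ i', f i' ^ 2 := by
  have hcol' (i' : Fin M') : (M : ℝ≥0∞)⁻¹ * ∑ i, κ i' i ≤ (M' : ℝ≥0∞)⁻¹ := by
    rw [ENNReal.le_inv_iff_mul_le, mul_comm, ← mul_assoc, ← div_eq_mul_inv]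
    exact hcol i'
  calc _ ≤ (M : ℝ≥0∞)⁻¹ * ∑ i, ∑ i', κ i' i * f i' ^ 2 := by
        gcongr with i
        refine (pow_le_pow_left' (hg i) 2).trans ((sq_sum_mul_le _ _).trans ?_)
        exact mul_le_of_le_one_left' (hrow i)
    _ = ∑ i', ((M : ℝ≥0∞)⁻¹ * ∑ i, κ i' i) * f i' ^ 2 := by
        simp only [Finset.sum_comm (s := Finset.univ (α := Fin M)), Finset.mul_sum,
          Finset.sum_mul, mul_assoc]
    _ ≤ ∑ i', (M' : ℝ≥0∞)⁻¹ * f i' ^ 2 := by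
        gcongr with i'
        exact hcol' i'
    _ = _ := (Finset.mul_sum ..).symm

lemma featureNorm_le_of_schur {M' : ℕ} {κ : Fin M' → Fin M → ℝ≥0∞}
    (hrow : ∀ i, ∑ i', κ i' i ≤ 1) (hcol : ∀ i', (M' : ℝ≥0∞) / M * ∑ i, κ i' i ≤ 1)
    {x : Feature M'} {D : ℝ≥0∞}
    (hxy : ∀ i, eLpNorm (channel y i) 2 jointMeasure
      ≤ ∑ i', κ i' i * (D * eLpNorm (channel x i') 2 jointMeasure)) :
    featureNorm Ω y ≤ D * featureNorm Ω x := by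
  rw [← ENNReal.pow_le_pow_left_iff two_ne_zero, mul_pow, featureNorm_sq, featureNorm_sq,
    mul_left_comm (D ^ 2)]
  refine mul_le_mul_right ((sum_sq_le_of_schur hrow hcol hxy).trans_eq ?_) _
  simp only [mul_pow, ← Finset.mul_sum]
  ring

end Features

/-! ### Layers -/

section Layers

variable {τ : ℂ → ℂ} {ε : ℝ} {M' M : ℕ} {σ : ℝ → ℝ} {W : Fin M' → Fin M → ℂ × S1 → ℝ}
  {b : Fin M → ℝ} {κ : Fin M' → Fin M → ℝ≥0∞} {x y : Feature M'} {c d : Fin M' → ℝ}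

/-- A joint convolutional layer. -/
def convLayer (σ : ℝ → ℝ) (W : Fin M' → Fin M → ℂ × S1 → ℝ) (b : Fin M → ℝ) (x : Feature M') :
    Feature M := fun u α i => σ (∑ i', jointConv (W i' i) (channel x i') (u, α) + b i)

/-- The constant values of the output of a layer whose input has the constant channels `c`. -/
def layerConst (σ : ℝ → ℝ) (W : Fin M' → Fin M → ℂ × S1 → ℝ) (b : Fin M → ℝ) (c : Fin M' → ℝ) :
    Fin M → ℝ := fun i => σ (∑ i', c i' * ∫ p, W i' i p ∂jointMeasure + b i)

/-- The filters `W` have deformation bounds `κ` for which Schur's test over the channels makes the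
layer non-expansive. -/
structure IsNonexpansiveBank (τ : ℂ → ℂ) (ε : ℝ) (W : Fin M' → Fin M → ℂ × S1 → ℝ)
    (κ : Fin M' → Fin M → ℝ≥0∞) : Prop where
  bound : ∀ i' i, IsDeformationBound τ ε (W i' i) (κ i' i)
  row : ∀ i, ∑ i', κ i' i ≤ 1
  col : ∀ i', (M' : ℝ≥0∞) / M * ∑ i, κ i' i ≤ 1

lemma eLpNorm_lipschitz_sub_le (hσ : LipschitzWith 1 σ) {f g : Fin M' → ℂ × S1 → ℝ}
    (hf : ∀ i, Measurable (f i)) (hg : ∀ i, Measurable (g i)) (s : ℝ) :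
    eLpNorm (fun p => σ (∑ i, f i p + s) - σ (∑ i, g i p + s)) 2 jointMeasure
      ≤ ∑ i, eLpNorm (fun p => f i p - g i p) 2 jointMeasure := by
  refine (eLpNorm_mono (g := ∑ i, fun p => f i p - g i p) fun p => ?_).trans
    (eLpNorm_sum_le (fun i _ => ((hf i).sub (hg i)).aestronglyMeasurable) one_le_two)
  simpa [Real.dist_eq] using hσ.dist_le_mul (∑ i, f i p + s) (∑ i, g i p + s)

namespace IsNonexpansiveBank

lemma ne_top (h : IsNonexpansiveBank τ ε W κ) (i' : Fin M') (i : Fin M) : κ i' i ≠ ∞ :=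
  ne_top_of_le_ne_top ENNReal.one_ne_top <|
    (Finset.single_le_sum (f := fun i' => κ i' i) (fun _ _ => zero_le)
      (Finset.mem_univ i')).trans (h.row i)

lemma measurable_channel_convLayer (h : IsNonexpansiveBank τ ε W κ) (hσ : LipschitzWith 1 σ)
    (hx : ∀ i', Measurable (channel x i')) (i : Fin M) :
    Measurable (channel (convLayer σ W b x) i) :=
  hσ.continuous.measurable.comp ((Finset.measurable_fun_sum _ fun i' _ =>
    measurable_jointConv (h.bound i' i).measurable (hx i')).add_const _)

lemma eLpNorm_convLayer_sub_le (h : IsNonexpansiveBank τ ε W κ) (hσ : LipschitzWith 1 σ)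
    (hx : Centered x c) (hy : Centered y d) (i : Fin M) :
    eLpNorm (channel (convLayer σ W b x - convLayer σ W b y) i) 2 jointMeasure
      ≤ ∑ i', κ i' i * (1 * eLpNorm (channel (x - y) i') 2 jointMeasure) := by
  refine (eLpNorm_lipschitz_sub_le hσ
    (fun i' => measurable_jointConv (h.bound i' i).measurable (hx i').measurable)
    (fun i' => measurable_jointConv (h.bound i' i).measurable (hy i').measurable) (b i)).trans ?_
  gcongr with i'
  rw [one_mul]
  exact (h.bound i' i).eLpNorm_jointConv_sub_le (h.ne_top i' i) (hx i') (hy i')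

lemma featureNorm_convLayer_sub_le (h : IsNonexpansiveBank τ ε W κ) (hσ : LipschitzWith 1 σ)
    (Ω : Set ℂ) (hx : Centered x c) (hy : Centered y d) :
    featureNorm Ω (convLayer σ W b x - convLayer σ W b y) ≤ featureNorm Ω (x - y) :=
  (featureNorm_le_of_schur Ω h.row h.col (h.eLpNorm_convLayer_sub_le hσ hx hy)).trans_eq
    (one_mul _)

lemma convLayer_constFeature (h : IsNonexpansiveBank τ ε W κ) (c : Fin M' → ℝ) :
    convLayer σ W b (constFeature c) = constFeature (layerConst σ W b c) := by
  ext u α i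
  simp only [convLayer, constFeature, layerConst]
  congr 2
  exact Finset.sum_congr rfl fun i' _ => jointConv_const (h.bound i' i).measurable _ _

lemma featureNorm_convLayer_sub_constFeature_le (h : IsNonexpansiveBank τ ε W κ)
    (hσ : LipschitzWith 1 σ) (Ω : Set ℂ) (hx : Centered x c) :
    featureNorm Ω (convLayer σ W b x - constFeature (layerConst σ W b c))
      ≤ featureNorm Ω (x - constFeature c) := by
  rw [← h.convLayer_constFeature]
  exact h.featureNorm_convLayer_sub_le hσ Ω hx (centered_constFeature c)

lemma centered_convLayer (h : IsNonexpansiveBank τ ε W κ) (hσ : LipschitzWith 1 σ)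
    (hx : Centered x c) : Centered (convLayer σ W b x) (layerConst σ W b c) := fun i => by
  have hmeas := h.measurable_channel_convLayer (b := b) hσ (fun i' => (hx i').measurable) i
  refine ⟨hmeas, (hmeas.sub_const _).aestronglyMeasurable, ?_⟩
  have hle := h.eLpNorm_convLayer_sub_le (b := b) hσ hx (centered_constFeature c) i
  rw [h.convLayer_constFeature] at hle
  refine hle.trans_lt (ENNReal.sum_lt_top.2 fun i' _ => ?_)
  rw [one_mul]
  exact ENNReal.mul_lt_top (h.ne_top i' i).lt_top (hx i').memLp.eLpNorm_lt_top

lemma featureNorm_commutator_le (h : IsNonexpansiveBank τ ε W κ) (hτ : ContractiveField τ ε)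
    (hσ : LipschitzWith 1 σ) (Ω : Set ℂ) (hx : Centered x c) :
    featureNorm Ω (convLayer σ W b (deformFeature τ x) - deformFeature τ (convLayer σ W b x))
      ≤ ENNReal.ofReal (commutatorConst ε) * featureNorm Ω (x - constFeature c) := by
  refine featureNorm_le_of_schur Ω h.row h.col fun i => ?_
  have hmeas (i' : Fin M') : Measurable (jointConv (W i' i) (channel x i')) :=
    measurable_jointConv (h.bound i' i).measurable (hx i').measurable
  refine (eLpNorm_lipschitz_sub_le hσ
    (fun i' => measurable_jointConv (h.bound i' i).measurable ((hx i').comp_deform hτ).measurable)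
    (fun i' => (hmeas i').comp hτ.measurable_deform) (b i)).trans ?_
  gcongr with i'
  rw [mul_left_comm, ← mul_assoc]
  exact (h.bound i' i).eLpNorm_commutator_le hτ (h.ne_top i' i) (hx i')

end IsNonexpansiveBank

end Layers

/-! ### Rotations and approximate equivariance of a layer -/

section Rotation

variable {M : ℕ} {x x' : Feature M} {c : Fin M → ℝ} {τ : ℂ → ℂ} {ε : ℝ}

/-- The action `(u, α) ↦ (ρ u, α - t)` of a rotation on the plane times the circle. -/
def rotMap (u₀ : ℂ) (t : S1) (p : ℂ × S1) : ℂ × S1 := (rotAbout u₀ t p.1, p.2 - t)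

lemma measurePreserving_rotMap (u₀ : ℂ) (t : S1) :
    MeasurePreserving (rotMap u₀ t) jointMeasure jointMeasure := by
  convert! (measurePreserving_add_left jointMeasure ((u₀, 0) : ℂ × S1)).comp
    (measurePreserving_frame (u₀, t)) using 1
  ext p <;> simp [rotMap, frame, rotAbout, rot]

lemma frame_rotMap (u₀ : ℂ) (t : S1) (P q : ℂ × S1) :
    frame (rotMap u₀ t P) (rotMap u₀ t q) = frame P q := by
  have htoCircle : (AddCircle.toCircle P.2 : ℂ)
      = AddCircle.toCircle (P.2 - t) * AddCircle.toCircle t := by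
    rw [← Circle.coe_mul, ← AddCircle.toCircle_add, sub_add_cancel]
  refine Prod.ext ?_ (sub_sub_sub_cancel_right _ _ _)
  simp only [frame, rotMap, rotAbout, rot, htoCircle]
  ring

lemma jointConv_comp_rotMap {W x : ℂ × S1 → ℝ} (hW : Measurable W) (hx : Measurable x) (u₀ : ℂ)
    (t : S1) (P : ℂ × S1) : jointConv W (x ∘ rotMap u₀ t) P = jointConv W x (rotMap u₀ t P) := by
  have hrot := measurePreserving_rotMap u₀ t
  have hxW : Measurable fun q => x q * W (frame (rotMap u₀ t P) q) :=
    hx.mul (hW.comp (measurable_frame_right _))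
  rw [jointConv, jointConv]
  conv_rhs => rw [← hrot.map_eq]
  rw [integral_map hrot.measurable.aemeasurable hxW.aestronglyMeasurable]
  simp only [frame_rotMap, Function.comp]

lemma Centered.rotateFeature (hx : Centered x c) (u₀ : ℂ) (t : S1) :
    Centered (rotateFeature u₀ t x) c := fun i =>
  ⟨(hx i).measurable.comp (measurePreserving_rotMap u₀ t).measurable,
    (hx i).memLp.comp_measurePreserving (measurePreserving_rotMap u₀ t)⟩

lemma measurable_channel_rotateFeature (hx : ∀ i, Measurable (channel x i)) (u₀ : ℂ) (t : S1)
    (i : Fin M) : Measurable (channel (rotateFeature u₀ t x) i) :=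
  (hx i).comp (measurePreserving_rotMap u₀ t).measurable

lemma featureNorm_rotateFeature (Ω : Set ℂ) (u₀ : ℂ) (t : S1)
    (hx : ∀ i, Measurable (channel x i)) :
    featureNorm Ω (rotateFeature u₀ t x) = featureNorm Ω x := by
  have hchannel (i : Fin M) :
      channel (rotateFeature u₀ t x) i = channel x i ∘ rotMap u₀ t := rfl
  have hnorm (i : Fin M) : eLpNorm (channel x i ∘ rotMap u₀ t) 2 jointMeasure
      = eLpNorm (channel x i) 2 jointMeasure :=
    eLpNorm_comp_measurePreserving (hx i).aestronglyMeasurable (measurePreserving_rotMap u₀ t)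
  simp only [featureNorm_eq, hchannel, hnorm]

/-- The features `x` and `x'`, equal to the constants `c` up to functions in `L²`, satisfy
`‖x - c‖ ≤ F` and `‖x' - T_ρ D_τ x‖ ≤ E`. This is what the induction over the layers controls. -/
structure IsEquivariantUpTo (Ω : Set ℂ) (τ : ℂ → ℂ) (u₀ : ℂ) (t : S1) (c : Fin M → ℝ)
    (F E : ℝ≥0∞) (x x' : Feature M) : Prop where
  centered_left : Centered x c
  centered_right : Centered x' c
  norm_le : featureNorm Ω (x - constFeature c) ≤ F
  error_le : featureNorm Ω (x' - rotateFeature u₀ t (deformFeature τ x)) ≤ E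

lemma isEquivariantUpTo_zero {Ω : Set ℂ} {u₀ : ℂ} {t : S1} (hτ : ContractiveField τ ε)
    (hx : Centered x c) :
    IsEquivariantUpTo Ω τ u₀ t c (featureNorm Ω (x - constFeature c)) 0 x
      (rotateFeature u₀ t (deformFeature τ x)) where
  centered_left := hx
  centered_right := (hx.deformFeature hτ).rotateFeature u₀ t
  norm_le := le_rfl
  error_le := by rw [sub_self, featureNorm_zero]

namespace IsNonexpansiveBank

variable {M' : ℕ} {σ : ℝ → ℝ} {W : Fin M → Fin M' → ℂ × S1 → ℝ} {b : Fin M' → ℝ}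
  {κ : Fin M → Fin M' → ℝ≥0∞}

lemma convLayer_rotateFeature (h : IsNonexpansiveBank τ ε W κ)
    (hx : ∀ i, Measurable (channel x i)) (u₀ : ℂ) (t : S1) :
    convLayer σ W b (rotateFeature u₀ t x) = rotateFeature u₀ t (convLayer σ W b x) := by
  ext u α i
  simp only [convLayer, rotateFeature]
  congr 2
  exact Finset.sum_congr rfl fun i' _ =>
    jointConv_comp_rotMap (h.bound i' i).measurable (hx i') u₀ t (u, α)

lemma featureNorm_convLayer_error_le (h : IsNonexpansiveBank τ ε W κ) (hτ : ContractiveField τ ε)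
    (hσ : LipschitzWith 1 σ) (Ω : Set ℂ) (u₀ : ℂ) (t : S1) (hx : Centered x c)
    (hx' : Centered x' c) :
    featureNorm Ω (convLayer σ W b x' - rotateFeature u₀ t (deformFeature τ (convLayer σ W b x)))
      ≤ featureNorm Ω (x' - rotateFeature u₀ t (deformFeature τ x))
        + ENNReal.ofReal (commutatorConst ε) * featureNorm Ω (x - constFeature c) := by
  have hD := hx.deformFeature hτ
  have hTD := hD.rotateFeature u₀ t
  have hsplit :
      convLayer σ W b x' - rotateFeature u₀ t (deformFeature τ (convLayer σ W b x))
        = (convLayer σ W b x' - convLayer σ W b (rotateFeature u₀ t (deformFeature τ x)))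
          + rotateFeature u₀ t
            (convLayer σ W b (deformFeature τ x) - deformFeature τ (convLayer σ W b x)) := by
    rw [h.convLayer_rotateFeature fun i => (hD i).measurable]
    exact (sub_add_sub_cancel _ _ _).symm
  have hcomm (i : Fin M') : Measurable (channel (convLayer σ W b (deformFeature τ x)
      - deformFeature τ (convLayer σ W b x)) i) :=
    (h.centered_convLayer hσ hD i).measurable.sub
      ((h.centered_convLayer hσ hx).deformFeature hτ i).measurable
  have hdiff (i : Fin M') : Measurable (channel (convLayer σ W b x'
      - convLayer σ W b (rotateFeature u₀ t (deformFeature τ x))) i) :=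
    (h.centered_convLayer hσ hx' i).measurable.sub (h.centered_convLayer hσ hTD i).measurable
  rw [hsplit]
  refine (featureNorm_add_le Ω hdiff (measurable_channel_rotateFeature hcomm u₀ t)).trans ?_
  rw [featureNorm_rotateFeature Ω u₀ t hcomm]
  exact add_le_add (h.featureNorm_convLayer_sub_le hσ Ω hx' hTD)
    (h.featureNorm_commutator_le hτ hσ Ω hx)

lemma isEquivariantUpTo_convLayer (h : IsNonexpansiveBank τ ε W κ) (hτ : ContractiveField τ ε)
    (hσ : LipschitzWith 1 σ) {Ω : Set ℂ} {u₀ : ℂ} {t : S1} {F E : ℝ≥0∞}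
    (hx : IsEquivariantUpTo Ω τ u₀ t c F E x x') :
    IsEquivariantUpTo Ω τ u₀ t (layerConst σ W b c) F
      (E + ENNReal.ofReal (commutatorConst ε) * F) (convLayer σ W b x) (convLayer σ W b x') where
  centered_left := h.centered_convLayer hσ hx.centered_left
  centered_right := h.centered_convLayer hσ hx.centered_right
  norm_le := (h.featureNorm_convLayer_sub_constFeature_le hσ Ω hx.centered_left).trans hx.norm_le
  error_le := (h.featureNorm_convLayer_error_le hτ hσ Ω u₀ t hx.centered_left
    hx.centered_right).trans (by gcongr; exacts [hx.error_le, hx.norm_le])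

end IsNonexpansiveBank

end Rotation

/-! ### Layers of a network -/

lemma isNonexpansiveBank_of_filterBound_le {τ : ℂ → ℂ} {ε : ℝ} {M' M : ℕ}
    {W : Fin M' → Fin M → ℂ × S1 → ℝ} {c : Fin M' → Fin M → ℝ≥0∞} (hc : filterBound c ≤ 1)
    (hW : ∀ i' i, IsDeformationBound τ ε (W i' i) (ENNReal.ofReal Real.pi * c i' i)) :
    IsNonexpansiveBank τ ε W fun i' i => ENNReal.ofReal Real.pi * c i' i where
  bound := hW
  row i := by
    rw [← Finset.mul_sum]
    refine (mul_le_mul_right ?_ _).trans hc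
    exact (le_iSup (fun i => ∑ i', c i' i) i).trans (le_max_left _ _)
  col i' := by
    rw [← Finset.mul_sum, mul_left_comm]
    refine (mul_le_mul_right ?_ _).trans hc
    exact (le_iSup (fun i' => (M' : ℝ≥0∞) / M * ∑ i, c i' i) i').trans (le_max_right _ _)

namespace RotDCFNet

variable (N : RotDCFNet) {τ : ℂ → ℂ} {ε : ℝ}

/-- Measurable representatives of the filters of the first layer, as functions on the plane times
the circle which do not depend on the angle. -/
def filter₁ (i' : Fin (N.M 0)) (i : Fin (N.M 1)) (p : ℂ × S1) : ℝ :=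
  (N.expansion₁ i' i).1.1.mk _ p.1

/-- Measurable representatives of the filters of layer `l + 2`. -/
def filter (l : ℕ) (i' : Fin (N.M (l + 1))) (i : Fin (N.M (l + 2))) : ℂ × S1 → ℝ :=
  (N.expansion l i' i).1.1.mk _

lemma isNonexpansiveBank_filter₁ (hτ : ContractiveField τ ε) (hA : N.A 0 ≤ 1) :
    IsNonexpansiveBank τ ε N.filter₁ fun i' i =>
      ENNReal.ofReal Real.pi * fbNormPlane (N.a₁ i' i) :=
  isNonexpansiveBank_of_filterBound_le hA fun i' i =>
    IsPlaneExpansion.isDeformationBound hτ (N.expansion₁ i' i)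
      (N.expansion₁ i' i).1.1.stronglyMeasurable_mk.measurable (N.expansion₁ i' i).1.1.ae_eq_mk

lemma isNonexpansiveBank_filter (hτ : ContractiveField τ ε) {l : ℕ} (hA : N.A (l + 1) ≤ 1) :
    IsNonexpansiveBank τ ε (N.filter l) fun i' i =>
      ENNReal.ofReal Real.pi * fbNormJoint (N.a l i' i) :=
  isNonexpansiveBank_of_filterBound_le hA fun i' i =>
    IsJointExpansion.isDeformationBound hτ (N.expansion l i' i)
      (N.expansion l i' i).1.1.stronglyMeasurable_mk.measurable (N.expansion l i' i).1.1.ae_eq_mk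

lemma jointLayer_eq_convLayer (l : ℕ) (x : Feature (N.M (l + 1))) :
    N.jointLayer l x = convLayer N.σ (N.filter l) (N.b l) x := by
  ext u α i
  simp only [jointLayer, convLayer]
  congr 2
  refine Finset.sum_congr rfl fun i' _ => ?_
  have htranslate := integral_add_left_eq_self (μ := jointMeasure)
    (fun q : ℂ × S1 => x q.1 q.2 i' * N.W l i' i (rot α (q.1 - u)) (q.2 - α)) (u, 0)
  simp only [Prod.fst_add, Prod.snd_add, zero_add, add_sub_cancel_left] at htranslate
  rw [htranslate]
  refine integral_congr_ae ?_
  filter_upwards [(measurePreserving_frame (u, α)).quasiMeasurePreserving.ae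
    (N.expansion l i' i).1.1.ae_eq_mk] with q hq
  exact congrArg (x q.1 q.2 i' * ·) hq

end RotDCFNet

/-- An image, as a feature which does not depend on the angle. -/
def liftImage {M : ℕ} (x : Image M) : Feature M := fun u _ i => x u i

lemma RotDCFNet.firstLayer_eq_convLayer (N : RotDCFNet) {x : Image (N.M 0)} {f : Feature (N.M 0)}
    (hf : ∀ i, channel (liftImage x) i =ᵐ[jointMeasure] channel f i) :
    N.firstLayer x = convLayer N.σ N.filter₁ N.b₁ f := by
  ext u α i
  simp only [firstLayer, convLayer]
  congr 2
  refine Finset.sum_congr rfl fun i' _ => ?_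
  have htranslate := integral_add_left_eq_self (μ := (volume : Measure ℂ))
    (fun q : ℂ => x q i' * N.W₁ i' i (rot α (q - u))) u
  have hcircle := integral_fun_fst (μ := (volume : Measure ℂ)) (ν := circleMeasure)
    (fun q : ℂ => x q i' * N.W₁ i' i (rot α (q - u)))
  simp only [add_sub_cancel_left] at htranslate
  simp only [probReal_univ, one_smul] at hcircle
  rw [htranslate, ← hcircle]
  refine integral_congr_ae ?_
  filter_upwards [(Measure.quasiMeasurePreserving_fst.comp
    (measurePreserving_frame (u, α)).quasiMeasurePreserving).ae (N.expansion₁ i' i).1.1.ae_eq_mk,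
    hf i'] with q hWq hxq
  exact congrArg₂ (· * ·) hxq hWq

section Image

variable {M : ℕ} {x : Image M} {f : Feature M}

lemma featureNorm_eq_imageNorm (Ω : Set ℂ) (hx : ∀ i, AEStronglyMeasurable (fun u => x u i) volume)
    (hf : ∀ i, channel (liftImage x) i =ᵐ[jointMeasure] channel f i) :
    featureNorm Ω f = imageNorm Ω x := by
  unfold featureNorm imageNorm
  congr! 4 with i
  calc ∫⁻ p, ‖channel f i p‖ₑ ^ 2 ∂jointMeasure
      = ∫⁻ p, ‖x p.1 i‖ₑ ^ 2 ∂jointMeasure :=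
        lintegral_congr_ae ((hf i).mono fun p hp => congrArg (‖·‖ₑ ^ 2) hp.symm)
    _ = ∫⁻ u, ‖x u i‖ₑ ^ 2 := by
        rw [lintegral_prod _ ((hx i).comp_fst.enorm.pow_const 2)]
        simp only [lintegral_const, measure_univ, mul_one]

lemma exists_centered_ae_eq_liftImage (hx : ∀ i, MemLp (fun u => x u i) 2 volume) :
    ∃ f : Feature M, Centered f 0 ∧ ∀ i, channel (liftImage x) i =ᵐ[jointMeasure] channel f i := by
  refine ⟨liftImage fun u i => (hx i).1.mk _ u, fun i => ⟨?_, ?_⟩, fun i => ?_⟩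
  · exact (hx i).1.stronglyMeasurable_mk.measurable.comp measurable_fst
  · simp only [Pi.zero_apply, sub_zero]
    exact ((memLp_congr_ae (hx i).1.ae_eq_mk).1 (hx i)).comp_fst circleMeasure
  · exact Measure.quasiMeasurePreserving_fst.ae (hx i).1.ae_eq_mk

lemma ContractiveField.ae_eq_rotateFeature_deformFeature {τ : ℂ → ℂ} {ε : ℝ}
    (hτ : ContractiveField τ ε) (u₀ : ℂ) (t : S1)
    (hf : ∀ i, channel (liftImage x) i =ᵐ[jointMeasure] channel f i) (i : Fin M) :
    channel (liftImage (rotateImage u₀ t (deformImage τ x))) i =ᵐ[jointMeasure]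
      channel (rotateFeature u₀ t (deformFeature τ f)) i :=
  (hτ.quasiMeasurePreserving_deform.comp
    (measurePreserving_rotMap u₀ t).quasiMeasurePreserving).ae_eq_comp (hf i)

end Image

/-! ### Equivariance of a network -/

lemma RotDCFNet.exists_isEquivariantUpTo_output (N : RotDCFNet) {τ : ℂ → ℂ} {ε : ℝ}
    (hτ : ContractiveField τ ε) (hσ : LipschitzWith 1 N.σ) (Ω : Set ℂ) (u₀ : ℂ) (t : S1)
    {x₀ : Image (N.M 0)} (hx₀ : ∀ i, MemLp (fun u => x₀ u i) 2 volume) {l : ℕ}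
    (hA : ∀ k ≤ l, N.A k ≤ 1) :
    ∃ c, IsEquivariantUpTo Ω τ u₀ t c (imageNorm Ω x₀)
      (((l + 1 : ℕ) : ℝ≥0∞) * ENNReal.ofReal (commutatorConst ε) * imageNorm Ω x₀)
      (N.output x₀ l) (N.output (rotateImage u₀ t (deformImage τ x₀)) l) := by
  induction l with
  | zero =>
    obtain ⟨f, hfc, hf⟩ := exists_centered_ae_eq_liftImage hx₀
    have hnorm : featureNorm Ω (f - constFeature 0) = imageNorm Ω x₀ := by
      rw [← featureNorm_eq_imageNorm Ω (fun i => (hx₀ i).1) hf]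
      congr 1
      exact sub_zero f
    have hlayer := (N.isNonexpansiveBank_filter₁ hτ (hA 0 le_rfl)).isEquivariantUpTo_convLayer
      (b := N.b₁) hτ hσ (isEquivariantUpTo_zero (Ω := Ω) (u₀ := u₀) (t := t) hτ hfc)
    rw [hnorm, ← N.firstLayer_eq_convLayer hf,
      ← N.firstLayer_eq_convLayer (hτ.ae_eq_rotateFeature_deformFeature u₀ t hf)] at hlayer
    exact ⟨_, by simpa [output] using hlayer⟩
  | succ l ih =>
    obtain ⟨c, hc⟩ := ih fun k hk => hA k (by lia)
    have hlayer := (N.isNonexpansiveBank_filter hτ (hA (l + 1) le_rfl)).isEquivariantUpTo_convLayer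
      (b := N.b l) hτ hσ hc
    refine ⟨layerConst N.σ (N.filter l) (N.b l) c, ?_⟩
    rw [output, output, jointLayer_eq_convLayer, jointLayer_eq_convLayer]
    convert hlayer using 1
    push_cast
    ring

lemma contractiveField_gradSup {τ : ℂ → ℂ} (hτ : Differentiable ℝ τ) (hlt : gradSup τ < 1) :
    ContractiveField τ (gradSup τ).toReal where
  differentiable := hτ
  norm_fderiv_le u := by
    rw [← toReal_enorm]
    exact ENNReal.toReal_mono hlt.ne_top (le_iSup (fun u => ‖fderiv ℝ τ u‖ₑ) u)
  lt_one := by simpa using (ENNReal.toReal_lt_toReal hlt.ne_top ENNReal.one_ne_top).2 hlt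

lemma commutatorConst_le {ε : ℝ} (hε : 0 ≤ ε) (hε' : ε ≤ 1 / 5) : commutatorConst ε ≤ 8 * ε := by
  have hinv : (1 - ε)⁻¹ ≤ 5 / 4 := by
    rw [inv_le_comm₀ (by linarith) (by norm_num)]
    linarith
  have hinv₀ : 0 ≤ (1 - ε)⁻¹ := inv_nonneg.2 (by linarith)
  calc commutatorConst ε
      ≤ ((1 + 1 / 5) ^ 2 * (5 / 4) ^ 3 + 2 + 1 / 5) * ε * (5 / 4) := by
        unfold commutatorConst
        gcongr
    _ ≤ 8 * ε := by linarith

lemma ofReal_commutatorConst_toReal_le {g : ℝ≥0∞} (hg : g < 1 / 5) :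
    ENNReal.ofReal (commutatorConst g.toReal) ≤ 2 * 4 * g := by
  have htoReal : g.toReal ≤ 1 / 5 := by
    simpa using ENNReal.toReal_mono (by simp) hg.le
  calc ENNReal.ofReal (commutatorConst g.toReal)
      ≤ ENNReal.ofReal (2 * 4 * g.toReal) := by
        gcongr
        exact (commutatorConst_le ENNReal.toReal_nonneg htoReal).trans_eq (by norm_num)
    _ = 2 * 4 * g := by
        rw [ENNReal.ofReal_mul (by norm_num), ENNReal.ofReal_toReal hg.ne_top]
        norm_num

end

end RotDCF

open RotDCF in
theorem proposition3p3_general (N : RotDCFNet) (Ω : Set ℂ) (_hΩ_pos : volume Ω ≠ 0)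
    (_hΩ_fin : volume Ω ≠ ∞) (hσ : LipschitzWith 1 N.σ) {τ : ℂ → ℂ} (hτ : Differentiable ℝ τ)
    (hlt : gradSup τ < 1) (u₀ : ℂ) (t : S1) {x₀ : Image (N.M 0)}
    (hx₀ : ∀ i, MemLp (fun u => x₀ u i) 2 volume) {l : ℕ} (hA : ∀ k ≤ l, N.A k ≤ 1) :
    featureNorm Ω
        (N.output (rotateImage u₀ t (deformImage τ x₀)) l
          - rotateFeature u₀ t (deformFeature τ (N.output x₀ l)))
      ≤ ((l + 1 : ℕ) : ℝ≥0∞) * ENNReal.ofReal (commutatorConst (gradSup τ).toReal)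
        * imageNorm Ω x₀ := by
  obtain ⟨c, hc⟩ := N.exists_isEquivariantUpTo_output (contractiveField_gradSup hτ hlt) hσ Ω u₀ t
    hx₀ hA
  exact hc.error_le

open RotDCF in
/-- Approximate equivariance at all layers. The index `l : ℕ` stands for the layer `l + 1`, so that
layers `1, …, L` are indexed by `l < L`. -/
theorem proposition3p3
    (N : RotDCFNet)
    (L : ℕ)
    (Ω : Set ℂ) (hΩ : MeasurableSet Ω) (hΩ_pos : volume Ω ≠ 0) (hΩ_fin : volume Ω ≠ ∞)
    (hA1 : LipschitzWith 1 N.σ)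
    (hA2 : ∀ l < L, N.A l ≤ 1)
    (τ : ℂ → ℂ) (hτ : ContDiff ℝ 2 τ)
    (hA3 : gradSup τ < 1 / 5)
    (u₀ : ℂ) (t : S1)
    (x₀ : Image (N.M 0)) (hx₀ : ∀ i, MemLp (fun u => x₀ u i) 2 volume)
    (l : ℕ) (hl : l < L) :
    featureNorm Ω
        (N.output (rotateImage u₀ t (deformImage τ x₀)) l
          - rotateFeature u₀ t (deformFeature τ (N.output x₀ l)))
      ≤ 2 * 4 * ((l + 1 : ℕ) : ℝ≥0∞) * gradSup τ * imageNorm Ω x₀ := by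
  have hlt : gradSup τ < 1 := hA3.trans (by norm_num)
  refine (proposition3p3_general N Ω hΩ_pos hΩ_fin hA1 (hτ.differentiable two_ne_zero) hlt u₀ t
    hx₀ fun k hk => hA2 k (hk.trans_lt hl)).trans ?_
  rw [mul_comm (2 * 4 : ℝ≥0∞), mul_assoc _ (2 * 4 : ℝ≥0∞)]
  gcongr
  exact ofReal_commutatorConst_toReal_le hA3
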